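/- Let $G$ be a simple graph, possibly infinite and of any cardinality; $|G|$ is the number of its vertices. $G$ is $k$-connected if $|G|>k$ and $G-X$ is connected for every set $X$ of fewer than $k$ vertices; $G$ is $k$-edge-connected if $|G|\ge 2$ and $G-F$ is connected for every set $F$ of fewer than $k$ edges. (In particular $K^1$ is neither $1$-connected nor $1$-edge-connected.) $G$ is edge-minimally (vertex-minimally) $k$-connected if $G$ is $k$-connected but $G-e$ is not for any edge $e$ ($G-v$ is not for any vertex $v$); edge-minimally and vertex-minimally $k$-edge-connected graphs are defined in the same way. A ray is a one-way infinite path. Two rays are equivalent if no finite set of vertices separates them, that is, if for every finite set $S$ of vertices they have tails in the same component of $G-S$. The set $\Omega(G)$ of ends of $G$ is the set of equivalence classes of rays. The vertex-degree (edge-degree) of an end is the supremum of the cardinalities of the sets of pairwise vertex-disjoint (edge-disjoint) rays in it. Let $V_n$ be the set of vertices of $G$ of degree at most $n$, and $\Omega^v_n$ (resp. $\Omega^e_n$) the set of ends of $G$ of vertex-degree (resp. edge-degree) at most $n$. Let $k\ge 1$ be an integer. Then: (a') If $G$ is edge-minimally $1$-connected (that is, a tree with at least two vertices), then $|V_1\cup\Omega^e_1|\ge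 |G|$ if $G$ is uncountable, with equality whenever $|\Omega(G)|\le |G|$; and $|V_1\cup\Omega^e_1|\ge 2$ if $|G|\le\aleph_0$. (b) If $G$ is vertex-minimally $k$-connected, and $G\ne K^2$ in case $k=1$, then $|V_{3k/2-1}\cup\Omega^v_k|\ge 2$. (c) If $G$ is edge-minimally $k$-edge-connected, then $|V_k\cup\Omega^e_k|\ge 2$. (d) If $G$ is vertex-minimally $k$-edge-connected, then $|V_k\cup\Omega^v_k|\ge 2$. (In (c) and (d) every vertex has degree at least $k$, so $V_k$ consists of the vertices of degree exactly $k$.) -/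

import Mathlib

open Cardinal

namespace SimpleGraph

/-- A ray (one-way infinite path), given by its vertices in order from its starting vertex. -/
structure Ray {V : Type*} (G : SimpleGraph V) where
  toFun : ℕ → V
  inj : Function.Injective toFun
  adj : ∀ n, G.Adj (toFun n) (toFun (n + 1))

/-- The vertex set of a ray. -/
def Ray.verts {V : Type*} {G : SimpleGraph V} (r : G.Ray) : Set V :=
  Set.range r.toFun

/-- The edge set of a ray. -/
def Ray.edges {V : Type*} {G : SimpleGraph V} (r : G.Ray) : Set (Sym2 V) :=
  Set.range fun n => s(r.toFun n, r.toFun (n + 1))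

/-- The component `C` of `G - S` contains a tail of the ray `r`. -/
def Ray.HasTailIn {V : Type*} {G : SimpleGraph V} (r : G.Ray) {S : Set V}
    (C : G.ComponentCompl S) : Prop :=
  ∃ m, ∀ n, m ≤ n → r.toFun n ∈ C

/-- Two rays are equivalent if no finite set of vertices separates them: for every finite set `S`
of vertices, they have tails in a common component of `G - S`. -/
def Ray.Equivalent {V : Type*} {G : SimpleGraph V} (r s : G.Ray) : Prop :=
  ∀ S : Set V, S.Finite → ∃ C : G.ComponentCompl S, r.HasTailIn C ∧ s.HasTailIn C

theorem Ray.exists_hasTailIn {V : Type*} {G : SimpleGraph V} (r : G.Ray) {S : Set V}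
    (hS : S.Finite) : ∃ C : G.ComponentCompl S, r.HasTailIn C := by
  have hfin : (r.toFun ⁻¹' S).Finite := hS.preimage r.inj.injOn
  obtain ⟨M, hM⟩ := hfin.bddAbove
  have hout : ∀ n, M + 1 ≤ n → r.toFun n ∉ S := by
    intro n hn h
    have : n ≤ M := hM h
    omega
  refine ⟨G.componentComplMk (hout (M + 1) le_rfl), M + 1, ?_⟩
  intro n hn
  induction n, hn using Nat.le_induction with
  | base => exact G.componentComplMk_mem _
  | succ n hn ih => exact ComponentCompl.mem_of_adj _ _ ih (hout _ (by omega)) (r.adj n)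

theorem Ray.HasTailIn.unique {V : Type*} {G : SimpleGraph V} {r : G.Ray} {S : Set V}
    {C D : G.ComponentCompl S} (hC : r.HasTailIn C) (hD : r.HasTailIn D) : C = D := by
  obtain ⟨m, hm⟩ := hC
  obtain ⟨n, hn⟩ := hD
  by_contra hne
  exact Set.disjoint_left.1 (ComponentCompl.pairwise_disjoint hne)
    (hm (max m n) (le_max_left _ _)) (hn (max m n) (le_max_right _ _))

/-- Equivalence of rays is an equivalence relation. -/
def raySetoid {V : Type*} (G : SimpleGraph V) : Setoid G.Ray where
  r := Ray.Equivalent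
  iseqv :=
    { refl := fun r _ hS => (r.exists_hasTailIn hS).imp fun _ h => ⟨h, h⟩
      symm := fun h S hS => (h S hS).imp fun _ h' => ⟨h'.2, h'.1⟩
      trans := by
        intro r s t h₁ h₂ S hS
        obtain ⟨C, hrC, hsC⟩ := h₁ S hS
        obtain ⟨D, hsD, htD⟩ := h₂ S hS
        obtain rfl := hsC.unique hsD
        exact ⟨C, hrC, htD⟩ }

/-- The set `Ω(G)` of ends of `G`: the equivalence classes of rays. -/
def Ends {V : Type*} (G : SimpleGraph V) : Type _ :=
  Quotient G.raySetoid

/-- The end that contains the ray `r`. -/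
def Ray.toEnd {V : Type*} {G : SimpleGraph V} (r : G.Ray) : G.Ends :=
  Quotient.mk G.raySetoid r

/-- The vertex-degree of an end: the supremum of the cardinalities of the sets of (vertex-)disjoint
rays in it. -/
noncomputable def endVertexDegree {V : Type*} {G : SimpleGraph V} (ω : G.Ends) : Cardinal :=
  ⨆ R : {R : Set G.Ray // (∀ r ∈ R, r.toEnd = ω) ∧ R.PairwiseDisjoint Ray.verts}, #R.1

/-- The edge-degree of an end: the supremum of the cardinalities of the sets of edge-disjoint
rays in it. -/
noncomputable def endEdgeDegree {V : Type*} {G : SimpleGraph V} (ω : G.Ends) : Cardinal :=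
  ⨆ R : {R : Set G.Ray // (∀ r ∈ R, r.toEnd = ω) ∧ R.PairwiseDisjoint Ray.edges}, #R.1

/-- `V_q`: the vertices of (finite) degree at most `q`. -/
def smallVertices {V : Type*} (G : SimpleGraph V) (q : ℚ) : Set V :=
  {v | (G.neighborSet v).Finite ∧ ((G.neighborSet v).ncard : ℚ) ≤ q}

/-- `Ω^v_k`: the ends of vertex-degree at most `k`. -/
def endsSmallVertexDegree {V : Type*} (G : SimpleGraph V) (k : ℕ) : Set G.Ends :=
  {ω | endVertexDegree ω ≤ k}

/-- `Ω^e_k`: the ends of edge-degree at most `k`. -/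
def endsSmallEdgeDegree {V : Type*} (G : SimpleGraph V) (k : ℕ) : Set G.Ends :=
  {ω | endEdgeDegree ω ≤ k}

/-- The union of a set of vertices and a set of ends, in the disjoint union of `V(G)` and
`Ω(G)`. -/
def vertexEndUnion {V : Type*} (G : SimpleGraph V) (A : Set V) (B : Set G.Ends) :
    Set (V ⊕ G.Ends) :=
  Sum.inl '' A ∪ Sum.inr '' B

/-- `k`-connected: more than `k` vertices, and deleting fewer than `k` vertices leaves a connected
graph. -/
def IsKConnected {V : Type*} (G : SimpleGraph V) (k : ℕ) : Prop :=
  (k : Cardinal) < #V ∧ ∀ X : Set V, X.encard < k → (G.induce Xᶜ).Connected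

/-- `k`-edge-connected: at least two vertices, and deleting fewer than `k` edges leaves a connected
graph. -/
def IsKEdgeConnected {V : Type*} (G : SimpleGraph V) (k : ℕ) : Prop :=
  Nontrivial V ∧ G.IsEdgeConnected k

/-- `G` is `k`-connected, but `G - e` is not, for every edge `e`. -/
def IsEdgeMinKConnected {V : Type*} (G : SimpleGraph V) (k : ℕ) : Prop :=
  G.IsKConnected k ∧ ∀ e ∈ G.edgeSet, ¬ (G.deleteEdges {e}).IsKConnected k

/-- `G` is `k`-edge-connected, but `G - e` is not, for every edge `e`. -/
def IsEdgeMinKEdgeConnected {V : Type*} (G : SimpleGraph V) (k : ℕ) : Prop :=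
  G.IsKEdgeConnected k ∧ ∀ e ∈ G.edgeSet, ¬ (G.deleteEdges {e}).IsKEdgeConnected k

/-- `G` is `k`-connected, but `G - v` is not, for every vertex `v`. -/
def IsVertexMinKConnected {V : Type*} (G : SimpleGraph V) (k : ℕ) : Prop :=
  G.IsKConnected k ∧ ∀ v : V, ¬ (G.induce {v}ᶜ).IsKConnected k

/-- `G` is `k`-edge-connected, but `G - v` is not, for every vertex `v`. -/
def IsVertexMinKEdgeConnected {V : Type*} (G : SimpleGraph V) (k : ℕ) : Prop :=
  G.IsKEdgeConnected k ∧ ∀ v : V, ¬ (G.induce {v}ᶜ).IsKEdgeConnected k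

end SimpleGraph

namespace SimpleGraph

/-! In (b), (c) and (d) minimality supplies small separators everywhere: a cut of `k` edges through
every edge in (c), an edge cut of `G - v` with fewer than `k` edges for every vertex `v` in (d), a
separator of `k` vertices through every vertex in (b), apart from tiny graphs. Such a separator has
two sides, and small vertices or ends are sought in both.

Inside one side, descend through connected sets with boundedly many outer neighbours. By Zorn's
lemma there is a minimal such set, or else a chain with empty intersection
(`exists_minimal_or_sequence`). The chain yields a decreasing sequence of connected sets that
vanishes, hence a ray with a tail in each of them. Finitely many disjoint rays of its end all have
to enter a set far down the sequence across its small border, so the degree of the end is at most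
`k`.

A minimal set is uncrossed with a separator that runs through it. In (c) submodularity of edge cuts
produces a smaller side unless the minimal one is a single vertex, which then has degree at most
`k`. In (d) the deleted vertex varies with the cut; `IsOptCut.encard_neighborSet_le_of_minimal`
shows that a minimal side contains a vertex of degree at most `k` or that its deleted vertex is one.
In (b) `IsFragment.small_compl_of_minimal` gives a fragment with at most `k / 2` vertices; each of
them has at most `k / 2 - 1` neighbours inside and `k` outside.

For (a'), the bound 2 is (c) with `k = 1`. For uncountable trees, root the tree and send each vertex
to a leaf or an end above it. Every end has edge-degree at most one, so only countably many vertices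
go to the same leaf or end. -/

/-! ### Connected sets and their components -/

theorem Reachable.mem_of_closed {W : Type*} {H : SimpleGraph W} {S : Set W}
    (hS : ∀ a ∈ S, ∀ b, H.Adj a b → b ∈ S) {u v : W} (h : H.Reachable u v) (hu : u ∈ S) :
    v ∈ S := by
  obtain ⟨p⟩ := h
  induction p with
  | nil => exact hu
  | cons hadj _ ih => exact ih (hS _ hu _ hadj)

theorem subset_of_induce_connected {V : Type*} {G : SimpleGraph V} {A I : Set V}
    (hA : (G.induce A).Connected) {a : V} (ha : a ∈ A) (haI : a ∈ I)
    (hcl : ∀ x ∈ I, ∀ y ∈ A, G.Adj x y → y ∈ I) : A ⊆ I := by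
  intro b hb
  exact Reachable.mem_of_closed (S := {x : A | x.1 ∈ I}) (fun x hx y hxy => hcl _ hx _ y.2 hxy)
    (hA.preconnected ⟨a, ha⟩ ⟨b, hb⟩) haI

/-- Every vertex of a set lies in a component of that set. -/
theorem exists_component {V : Type*} (G : SimpleGraph V) {A : Set V} {a : V} (ha : a ∈ A) :
    ∃ K ⊆ A, a ∈ K ∧ (G.induce K).Connected ∧ ∀ x ∈ K, ∀ y ∈ A, G.Adj x y → y ∈ K := by
  let K : Set V := {y | ∃ h : y ∈ A, (G.induce A).Reachable ⟨a, ha⟩ ⟨y, h⟩}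
  have haK : a ∈ K := ⟨ha, Reachable.refl _⟩
  have hcl : ∀ x ∈ K, ∀ y ∈ A, G.Adj x y → y ∈ K := by
    rintro x ⟨hx, hr⟩ y hy hxy
    exact ⟨hy, hr.trans (Adj.reachable (show (G.induce A).Adj ⟨x, hx⟩ ⟨y, hy⟩ from hxy))⟩
  refine ⟨K, fun y hy => hy.1, haK, ?_, hcl⟩
  have key : ∀ y : K, (G.induce K).Reachable ⟨a, haK⟩ y := by
    rintro ⟨y, hyA, hr⟩
    have := Reachable.mem_of_closed
      (S := {z : A | ∃ h : z.1 ∈ K, (G.induce K).Reachable ⟨a, haK⟩ ⟨z.1, h⟩}) ?_ hr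
      ⟨haK, Reachable.refl _⟩
    · exact this.2
    · rintro x ⟨hx, hxr⟩ z hxz
      have hz := hcl _ hx _ z.2 hxz
      exact ⟨hz, hxr.trans (Adj.reachable (show (G.induce K).Adj ⟨x.1, hx⟩ ⟨z.1, hz⟩ from hxz))⟩
  have : Nonempty K := ⟨⟨a, haK⟩⟩
  exact ⟨fun x y => (key x).symm.trans (key y)⟩

/-- The vertices outside `A` that have a neighbour in `A`. -/
def outerBoundary {V : Type*} (G : SimpleGraph V) (A : Set V) : Set V :=
  {y | y ∉ A ∧ ∃ x ∈ A, G.Adj x y}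

/-! ### Rays from decreasing sequences of connected sets -/

theorem exists_closer_neighbor {W : Type*} {H : SimpleGraph W} (hH : H.Preconnected) {u t : W}
    (hut : u ≠ t) : ∃ w, H.Adj u w ∧ H.dist w t < H.dist u t := by
  obtain ⟨p, hp⟩ := (hH u t).exists_walk_length_eq_dist
  cases p with
  | nil => exact absurd rfl hut
  | cons hadj q =>
    refine ⟨_, hadj, ?_⟩
    rw [← hp, Walk.length_cons]
    exact Nat.lt_succ_of_le (dist_le q)

/-- A sequence of vertices in which consecutive members are equal or adjacent, and that runs
through a given decreasing sequence of connected sets. -/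
theorem exists_lazy_walk {V : Type*} {G : SimpleGraph V} {A : ℕ → Set V} (hanti : Antitone A)
    (hconn : ∀ n, (G.induce (A n)).Connected) :
    ∃ w : ℕ → V, (∀ i, w i = w (i + 1) ∨ G.Adj (w i) (w (i + 1))) ∧
      ∀ n, ∃ m, ∀ i, m ≤ i → w i ∈ A n := by
  classical
  have hne : ∀ n, ∃ v, v ∈ A n := fun n => by
    obtain ⟨⟨v, hv⟩⟩ := (hconn n).nonempty
    exact ⟨v, hv⟩
  choose t ht using fun n => hne (n + 1)
  have ht' : ∀ n, t n ∈ A n := fun n => hanti (Nat.le_succ n) (ht n)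
  let μ : ℕ → V → ℕ := fun n u =>
    if h : u ∈ A n then (G.induce (A n)).dist ⟨u, h⟩ ⟨t n, ht' n⟩ else 0
  have hstep : ∀ n u, ∃ u', u ∈ A n → u ≠ t n → G.Adj u u' ∧ u' ∈ A n ∧ μ n u' < μ n u := by
    intro n u
    by_cases h : u ∈ A n ∧ u ≠ t n
    · obtain ⟨w, hw, hd⟩ := exists_closer_neighbor (hconn n).preconnected
        (u := ⟨u, h.1⟩) (t := ⟨t n, ht' n⟩) (fun e => h.2 (congrArg Subtype.val e))
      refine ⟨w.1, fun _ _ => ⟨hw, w.2, ?_⟩⟩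
      simp only [μ, dif_pos h.1, dif_pos w.2]
      exact hd
    · exact ⟨u, fun h1 h2 => absurd ⟨h1, h2⟩ h⟩
  choose next hnext using hstep
  -- In state `(n, u)` the walk is at `u ∈ A n` and heads for `t n`, which lies in `A (n + 1)` as
  -- well. On arrival only `n` advances and the vertex is repeated, which makes the walk lazy.
  let step : ℕ × V → ℕ × V := fun s => if s.2 = t s.1 then (s.1 + 1, s.2) else (s.1, next s.1 s.2)
  let st : ℕ → ℕ × V := fun i => step^[i] (0, t 0)
  have hst : ∀ i, st (i + 1) = step (st i) := fun i => Function.iterate_succ_apply' step i _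
  have hmem : ∀ i, (st i).2 ∈ A (st i).1 := by
    intro i
    induction i with
    | zero => exact ht' 0
    | succ i ih =>
      rw [hst]
      by_cases h : (st i).2 = t (st i).1
      · simp only [step, if_pos h]
        rw [h]
        exact ht _
      · simp only [step, if_neg h]
        exact (hnext _ _ ih h).2.1
  have hmono : Monotone fun i => (st i).1 := by
    refine monotone_nat_of_le_succ fun i => ?_
    simp only [hst, step]
    split_ifs
    · exact Nat.le_succ _
    · exact le_rfl
  have hadv : ∀ d i, μ (st i).1 (st i).2 ≤ d → ∃ j, (st j).1 = (st i).1 + 1 := by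
    intro d
    induction d with
    | zero =>
      intro i hi
      by_cases h : (st i).2 = t (st i).1
      · exact ⟨i + 1, by simp only [hst, step, if_pos h]⟩
      · have := (hnext _ _ (hmem i) h).2.2
        omega
    | succ d ih =>
      intro i hi
      by_cases h : (st i).2 = t (st i).1
      · exact ⟨i + 1, by simp only [hst, step, if_pos h]⟩
      · have h1 := (hnext _ _ (hmem i) h).2.2
        have h2 : st (i + 1) = ((st i).1, next (st i).1 (st i).2) := by
          rw [hst]
          simp only [step, if_neg h]
        obtain ⟨j, hj⟩ := ih (i + 1) (by rw [h2]; simp only; omega)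
        exact ⟨j, by rw [hj, h2]⟩
  have hreach : ∀ n, ∃ i, (st i).1 = n := by
    intro n
    induction n with
    | zero => exact ⟨0, rfl⟩
    | succ n ih =>
      obtain ⟨i, rfl⟩ := ih
      exact hadv _ i le_rfl
  refine ⟨fun i => (st i).2, fun i => ?_, fun n => ?_⟩
  · by_cases h : (st i).2 = t (st i).1
    · left
      simp only [hst, step, if_pos h]
    · right
      simp only [hst, step, if_neg h]
      exact (hnext _ _ (hmem i) h).1
  · obtain ⟨m, hm⟩ := hreach n
    refine ⟨m, fun i hi => hanti ?_ (hmem i)⟩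
    rw [← hm]
    exact hmono hi

/-- Erasing loops from a lazy walk that visits every vertex finitely often leaves a ray. -/
theorem exists_ray_of_lazy_walk {V : Type*} {G : SimpleGraph V} {w : ℕ → V}
    (hw : ∀ i, w i = w (i + 1) ∨ G.Adj (w i) (w (i + 1)))
    (hfin : ∀ v, ∃ m, ∀ i, m ≤ i → w i ≠ v) :
    ∃ (r : G.Ray) (φ : ℕ → ℕ), StrictMono φ ∧ ∀ j, r.toFun j = w (φ j) := by
  have hlast : ∀ i, ∃ l, i ≤ l ∧ w l = w i ∧ ∀ j, l < j → w j ≠ w i := by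
    intro i
    obtain ⟨m, hm⟩ := hfin (w i)
    have hbdd : ∀ j, w j = w i → j ≤ m := fun j hj => by
      by_contra h
      exact hm j (by omega) hj
    classical
    refine ⟨Nat.findGreatest (fun j => w j = w i) m, ?_, ?_, ?_⟩
    · exact Nat.le_findGreatest (hbdd i rfl) rfl
    · exact Nat.findGreatest_spec (P := fun j => w j = w i) (hbdd i rfl) rfl
    · intro j hj h
      exact absurd (Nat.le_findGreatest (P := fun j => w j = w i) (hbdd j h) h) (by omega)
  choose last h1 h2 h3 using hlast
  -- After the last visit to a vertex, step on and jump to the last visit to the new vertex; no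
  -- vertex is ever met again.
  let φ : ℕ → ℕ := fun j => Nat.rec (last 0) (fun _ l => last (l + 1)) j
  have hφ : ∀ j, φ (j + 1) = last (φ j + 1) := fun _ => rfl
  have hlst : ∀ j i, φ j < i → w i ≠ w (φ j) := by
    intro j i hi
    cases j with
    | zero =>
      change last 0 < i at hi
      change w i ≠ w (last 0)
      rw [h2]
      exact h3 _ _ hi
    | succ j =>
      rw [hφ] at hi ⊢
      rw [h2]
      exact h3 _ _ hi
  have hmono : StrictMono φ := strictMono_nat_of_lt_succ fun j => by
    rw [hφ]
    exact lt_of_lt_of_le (Nat.lt_succ_self _) (h1 _)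
  refine ⟨⟨fun j => w (φ j), ?_, ?_⟩, φ, hmono, fun _ => rfl⟩
  · intro i j hij
    rcases lt_trichotomy i j with h | h | h
    · exact absurd hij.symm (hlst _ _ (hmono h))
    · exact h
    · exact absurd hij (hlst _ _ (hmono h))
  · intro j
    rw [hφ, h2]
    rcases hw (φ j) with h | h
    · exact absurd h.symm (hlst _ _ (Nat.lt_succ_self _))
    · exact h

/-! ### Ends that live in a set, and bounds on their degrees -/

theorem componentCompl_subset {V : Type*} {G : SimpleGraph V} {A S : Set V}
    (hS : G.outerBoundary A ⊆ S) {C : G.ComponentCompl S} {x y : V} (hx : x ∈ C) (hxA : x ∈ A)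
    (hy : y ∈ C) : y ∈ A := by
  obtain ⟨hxS, rfl⟩ := hx
  obtain ⟨hyS, h⟩ := hy
  rw [ConnectedComponent.eq] at h
  refine Reachable.mem_of_closed (S := {z : (Sᶜ : Set V) | z.1 ∈ A}) ?_ h.symm hxA
  intro a ha b hab
  by_contra hb
  exact b.2 (hS ⟨hb, a.1, ha, hab⟩)

/-- A set contains tails of all rays of an end. -/
def LivesIn {V : Type*} {G : SimpleGraph V} (ω : G.Ends) (A : Set V) : Prop :=
  ∀ r : G.Ray, r.toEnd = ω → ∃ m, ∀ i, m ≤ i → r.toFun i ∈ A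

/-- The finite outer boundary of `A` separates `A` from the rest, so an equivalent ray cannot have
its tail on the other side. -/
theorem Ray.livesIn_toEnd {V : Type*} {G : SimpleGraph V} (r : G.Ray) {A : Set V}
    (hfin : (G.outerBoundary A).Finite) (hr : ∃ m, ∀ i, m ≤ i → r.toFun i ∈ A) :
    LivesIn r.toEnd A := by
  intro s hs
  obtain ⟨C, ⟨m, hm⟩, ⟨m', hm'⟩⟩ := (Quotient.exact hs : s.Equivalent r) _ hfin
  obtain ⟨l, hl⟩ := hr
  exact ⟨m, fun i hi => componentCompl_subset subset_rfl (hm' (max m' l) (le_max_left _ _))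
    (hl _ (le_max_right _ _)) (hm i hi)⟩

theorem LivesIn.mono {V : Type*} {G : SimpleGraph V} {ω : G.Ends} {A B : Set V}
    (h : LivesIn ω A) (hAB : A ⊆ B) : LivesIn ω B :=
  fun r hr => (h r hr).imp fun _ hm i hi => hAB (hm i hi)

theorem LivesIn.ne {V : Type*} {G : SimpleGraph V} {ω ω' : G.Ends} {A B : Set V}
    (h : LivesIn ω A) (h' : LivesIn ω' B) (hAB : Disjoint A B) : ω ≠ ω' := by
  rintro rfl
  obtain ⟨r, hr⟩ := Quotient.exists_rep ω
  obtain ⟨m, hm⟩ := h r hr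
  obtain ⟨n, hn⟩ := h' r hr
  exact Set.disjoint_left.1 hAB (hm (max m n) (le_max_left _ _)) (hn _ (le_max_right _ _))

theorem exists_end_livesIn {V : Type*} {G : SimpleGraph V} {A : ℕ → Set V} (hanti : Antitone A)
    (hconn : ∀ n, (G.induce (A n)).Connected) (hfin : ∀ n, (G.outerBoundary (A n)).Finite)
    (hempty : ∀ v, ∃ n, v ∉ A n) : ∃ ω : G.Ends, ∀ n, LivesIn ω (A n) := by
  obtain ⟨w, hw, htail⟩ := exists_lazy_walk hanti hconn
  obtain ⟨r, φ, hφ, hr⟩ := exists_ray_of_lazy_walk hw fun v => by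
    obtain ⟨n, hn⟩ := hempty v
    obtain ⟨m, hm⟩ := htail n
    exact ⟨m, fun i hi h => hn (h ▸ hm i hi)⟩
  refine ⟨r.toEnd, fun n => r.livesIn_toEnd (hfin n) ?_⟩
  obtain ⟨m, hm⟩ := htail n
  exact ⟨m, fun i hi => by
    rw [hr]
    exact hm _ (hi.trans (hφ.id_le i))⟩

theorem exists_crossing {V : Type*} {G : SimpleGraph V} (r : G.Ray) {A : Set V}
    (h0 : r.toFun 0 ∉ A) (ht : ∃ m, ∀ i, m ≤ i → r.toFun i ∈ A) :
    ∃ i, r.toFun i ∉ A ∧ r.toFun (i + 1) ∈ A := by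
  by_contra! hcon
  obtain ⟨m, hm⟩ := ht
  have : ∀ i, r.toFun i ∉ A := fun i => by
    induction i with
    | zero => exact h0
    | succ i ih => exact hcon i ih
  exact this m (hm m le_rfl)

theorem exists_forall_notMem {V : Type*} {A : ℕ → Set V} (hanti : Antitone A)
    (hempty : ∀ v, ∃ n, v ∉ A n) {S : Set V} (hS : S.Finite) : ∃ n, ∀ v ∈ S, v ∉ A n := by
  choose f hf using hempty
  obtain ⟨M, hM⟩ := (hS.image f).bddAbove
  exact ⟨M, fun v hv h => hf v (hanti (hM (Set.mem_image_of_mem f hv)) h)⟩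

/-- Disjoint rays of an end that lives in every member of a vanishing sequence of sets cross the
borders of these sets in distinct places. -/
theorem card_rays_le {V β : Type*} {G : SimpleGraph V} {A : ℕ → Set V} (hanti : Antitone A)
    (hempty : ∀ v, ∃ n, v ∉ A n) {ω : G.Ends} (hω : ∀ n, LivesIn ω (A n)) {k : ℕ}
    (f : G.Ray → Set β) (X : ℕ → Set β) (hX : ∀ n, (X n).encard ≤ k)
    (hcross : ∀ n (r : G.Ray) i, r.toFun i ∉ A n → r.toFun (i + 1) ∈ A n → ∃ b ∈ X n, b ∈ f r)
    {R : Set G.Ray} (hR : ∀ r ∈ R, r.toEnd = ω) (hdisj : R.PairwiseDisjoint f) : #R ≤ k := by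
  by_contra hcon
  have hcard : ((k + 1 : ℕ) : ℕ∞) ≤ R.encard := by
    rw [not_le] at hcon
    by_contra hlt
    rw [not_le] at hlt
    have hle : R.encard ≤ k := by
      rw [Nat.cast_add, Nat.cast_one] at hlt
      exact Order.le_of_lt_add_one hlt
    have hfin : R.Finite := Set.finite_of_encard_le_coe hle
    rw [← hfin.cast_ncard_eq] at hle
    have h2 := Set.cast_ncard hfin
    rw [← h2] at hcon
    exact absurd (Nat.cast_le.1 hle) (not_le.2 (Nat.cast_lt.1 hcon))
  obtain ⟨R', hR', hR'card⟩ := Set.exists_subset_encard_eq hcard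
  have hR'fin : R'.Finite := Set.finite_of_encard_eq_coe hR'card
  -- With only `k + 1` rays there is one `A n` that misses all their first vertices. Each ray then
  -- has to enter it, through `k + 1` distinct members of `X n`.
  obtain ⟨n, hn⟩ := exists_forall_notMem hanti hempty (hR'fin.image fun r => r.toFun 0)
  have hb : ∀ r : G.Ray, ∃ b, r ∈ R' → b ∈ X n ∧ b ∈ f r := fun r => by
    by_cases hr : r ∈ R'
    · obtain ⟨i, hi, hi'⟩ := exists_crossing r (hn _ (Set.mem_image_of_mem _ hr))
        (hω n r (hR r (hR' hr)))
      obtain ⟨b, hb⟩ := hcross n r i hi hi'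
      exact ⟨b, fun _ => hb⟩
    · obtain ⟨b, -⟩ : ∃ b : β, True := by
        have : R'.Nonempty := by
          rw [← Set.encard_ne_zero, hR'card]
          simp
        obtain ⟨s, hs⟩ := this
        obtain ⟨i, hi, hi'⟩ := exists_crossing s (hn _ (Set.mem_image_of_mem _ hs))
          (hω n s (hR s (hR' hs)))
        obtain ⟨b, hb⟩ := hcross n s i hi hi'
        exact ⟨b, trivial⟩
      exact ⟨b, fun h => absurd h hr⟩
  choose g hg using hb
  have hinj : Set.InjOn g R' := by
    intro r hr s hs hrs
    by_contra hne
    exact Set.disjoint_left.1 (hdisj (hR' hr) (hR' hs) hne) (hg r hr).2 (hrs ▸ (hg s hs).2)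
  have h1 : (g '' R').encard ≤ k :=
    (Set.encard_le_encard (Set.image_subset_iff.2 fun r hr => (hg r hr).1)).trans (hX n)
  rw [hinj.encard_image, hR'card] at h1
  exact absurd (Nat.cast_le.1 h1) (by omega)

/-- Pairs `(a, b)` of adjacent vertices with `a ∈ A` and `b` outside `A` and `X`: the edges of
`G - X` that leave `A`. -/
def cutPairs {V : Type*} (G : SimpleGraph V) (X A : Set V) : Set (V × V) :=
  {p | p.1 ∈ A ∧ p.2 ∉ A ∧ p.2 ∉ X ∧ G.Adj p.1 p.2}

theorem endVertexDegree_le {V : Type*} {G : SimpleGraph V} {A : ℕ → Set V} (hanti : Antitone A)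
    (hempty : ∀ v, ∃ n, v ∉ A n) {ω : G.Ends} (hω : ∀ n, LivesIn ω (A n)) {k : ℕ}
    (hA : ∀ n, (G.outerBoundary (A n)).encard ≤ k) : endVertexDegree ω ≤ k :=
  ciSup_le' fun R => card_rays_le hanti hempty hω Ray.verts _ hA
    (fun _ r i hi hi' => ⟨r.toFun i, ⟨hi, _, hi', (r.adj i).symm⟩, i, rfl⟩) R.2.1 R.2.2

theorem endEdgeDegree_le {V : Type*} {G : SimpleGraph V} {A : ℕ → Set V} (hanti : Antitone A)
    (hempty : ∀ v, ∃ n, v ∉ A n) {ω : G.Ends} (hω : ∀ n, LivesIn ω (A n)) {k : ℕ}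
    (hA : ∀ n, (G.cutPairs ∅ (A n)).encard ≤ k) : endEdgeDegree ω ≤ k :=
  ciSup_le' fun R => card_rays_le hanti hempty hω Ray.edges
    (fun n => (fun p : V × V => s(p.1, p.2)) '' G.cutPairs ∅ (A n))
    (fun n => (Set.encard_image_le _ _).trans (hA n))
    (fun _ r i hi hi' => ⟨s(r.toFun i, r.toFun (i + 1)),
      ⟨(r.toFun (i + 1), r.toFun i), ⟨hi', hi, id, (r.adj i).symm⟩, Sym2.eq_swap⟩, i, rfl⟩)
    R.2.1 R.2.2

/-! ### Limits of chains, minimal sets and vanishing sequences -/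

/-- The filter of late members of the chain lets each single vertex settle inside or outside. Any
finite configuration of the limit therefore already occurs in a member, and intersections and unions
can be treated alike. -/
theorem exists_filter_sInter {V : Type*} {𝒞 : Set (Set V)} (hch : IsChain (· ⊆ ·) 𝒞)
    (hne : 𝒞.Nonempty) : ∃ l : Filter (Set V), l.NeBot ∧ (∀ᶠ A in l, A ∈ 𝒞) ∧
      ∀ y, ∀ᶠ A in l, (y ∈ A ↔ y ∈ ⋂₀ 𝒞) := by
  have : Nonempty 𝒞 := hne.to_subtype
  have : IsDirectedOrder (𝒞 : Set (Set V))ᵒᵈ := ⟨fun a b => by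
    rcases hch.total a.ofDual.2 b.ofDual.2 with h | h
    · exact ⟨a, le_rfl, h⟩
    · exact ⟨b, h, le_rfl⟩⟩
  refine ⟨Filter.map (fun A : (𝒞 : Set (Set V))ᵒᵈ => (A.ofDual : Set V)) Filter.atTop,
    inferInstance, Filter.eventually_map.2 (Filter.Eventually.of_forall fun A => A.ofDual.2), fun y => ?_⟩
  rw [Filter.eventually_map]
  by_cases hy : y ∈ ⋂₀ 𝒞
  · exact Filter.Eventually.of_forall fun A => ⟨fun _ => hy, fun _ => hy _ A.ofDual.2⟩
  · have hy' := hy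
    simp only [Set.mem_sInter, not_forall] at hy'
    obtain ⟨A, hA, hyA⟩ := hy'
    filter_upwards [Filter.eventually_ge_atTop (OrderDual.toDual (⟨A, hA⟩ : 𝒞))] with B hB
    exact ⟨fun h => absurd (hB h) hyA, fun h => absurd h hy⟩

theorem exists_filter_sUnion {V : Type*} {𝒞 : Set (Set V)} (hch : IsChain (· ⊆ ·) 𝒞)
    (hne : 𝒞.Nonempty) : ∃ l : Filter (Set V), l.NeBot ∧ (∀ᶠ A in l, A ∈ 𝒞) ∧
      ∀ y, ∀ᶠ A in l, (y ∈ A ↔ y ∈ ⋃₀ 𝒞) := by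
  have : Nonempty 𝒞 := hne.to_subtype
  have : IsDirectedOrder (𝒞 : Set (Set V)) := ⟨fun a b => by
    rcases hch.total a.2 b.2 with h | h
    · exact ⟨b, h, le_rfl⟩
    · exact ⟨a, le_rfl, h⟩⟩
  refine ⟨Filter.map (fun A : (𝒞 : Set (Set V)) => (A : Set V)) Filter.atTop,
    inferInstance, Filter.eventually_map.2 (Filter.Eventually.of_forall fun A => A.2), fun y => ?_⟩
  rw [Filter.eventually_map]
  by_cases hy : y ∈ ⋃₀ 𝒞
  · obtain ⟨A, hA, hyA⟩ := hy
    filter_upwards [Filter.eventually_ge_atTop (⟨A, hA⟩ : 𝒞)] with B hB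
    exact ⟨fun h => ⟨B, B.2, h⟩, fun _ => hB hyA⟩
  · exact Filter.Eventually.of_forall fun A => ⟨fun h => ⟨A, A.2, h⟩, fun h => absurd h hy⟩

/-- Lower semicontinuity: `n + 1` elements of the limit would lie together in one late `f a`. It
bounds borders and cuts of limits of chains. -/
theorem encard_le_of_frequently {α β : Type*} {l : Filter α} {f : α → Set β} {S : Set β} {n : ℕ}
    (hS : ∀ b ∈ S, ∀ᶠ a in l, b ∈ f a) (hf : ∃ᶠ a in l, (f a).encard ≤ n) : S.encard ≤ n := by
  by_contra hlt
  rw [not_le] at hlt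
  have h1 : ((n + 1 : ℕ) : ℕ∞) ≤ S.encard := by
    rw [Nat.cast_add, Nat.cast_one]
    exact Order.add_one_le_of_lt hlt
  obtain ⟨T, hTS, hT⟩ := Set.exists_subset_encard_eq h1
  have hTfin : T.Finite := Set.finite_of_encard_eq_coe hT
  have hev : ∀ᶠ a in l, ∀ b ∈ T, b ∈ f a := (Filter.eventually_all_finite hTfin).2
    fun b hb => hS b (hTS hb)
  obtain ⟨a, ha, ha'⟩ := (hf.and_eventually hev).exists
  have := (Set.encard_le_encard ha').trans ha
  rw [hT] at this
  exact absurd (Nat.cast_le.1 this) (by omega)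

theorem eventually_mem_outerBoundary {V : Type*} {G : SimpleGraph V} {l : Filter (Set V)}
    {I : Set V} (hl : ∀ y, ∀ᶠ A in l, (y ∈ A ↔ y ∈ I)) :
    ∀ b ∈ G.outerBoundary I, ∀ᶠ A in l, b ∈ G.outerBoundary A := by
  rintro b ⟨hb, x, hx, hxb⟩
  filter_upwards [hl b, hl x] with A h1 h2
  exact ⟨fun h => hb (h1.1 h), x, h2.2 hx, hxb⟩

theorem eventually_mem_cutPairs {V : Type*} {G : SimpleGraph V} {l : Filter (Set V)}
    {I : Set V} (hl : ∀ y, ∀ᶠ A in l, (y ∈ A ↔ y ∈ I)) (X : Set V) :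
    ∀ p ∈ G.cutPairs X I, ∀ᶠ A in l, p ∈ G.cutPairs X A := by
  rintro p ⟨h1, h2, h3, h4⟩
  filter_upwards [hl p.1, hl p.2] with A hA hA'
  exact ⟨hA.2 h1, fun h => h2 (hA'.1 h), h3, h4⟩

theorem outerBoundary_mono_union {V : Type*} {G : SimpleGraph V} {A B : Set V} (h : A ⊆ B) :
    A ∪ G.outerBoundary A ⊆ B ∪ G.outerBoundary B := by
  rintro y (hy | ⟨_, x, hx, hxy⟩)
  · exact Or.inl (h hy)
  · by_cases hyB : y ∈ B
    · exact Or.inl hyB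
    · exact Or.inr ⟨hyB, x, h hx, hxy⟩

/-- A chain of connected sets with boundedly many outer neighbours and empty intersection contains
a decreasing sequence with empty intersection. -/
theorem exists_vanishing_sequence {V : Type*} {G : SimpleGraph V} {𝒞 : Set (Set V)} {k : ℕ}
    (hch : IsChain (· ⊆ ·) 𝒞) (hne : 𝒞.Nonempty) (hconn : ∀ A ∈ 𝒞, (G.induce A).Connected)
    (hN : ∀ A ∈ 𝒞, (G.outerBoundary A).encard ≤ k) (hempty : ⋂₀ 𝒞 = ∅) :
    ∃ A : ℕ → Set V, Antitone A ∧ (∀ n, A n ∈ 𝒞) ∧ ∀ v, ∃ n, v ∉ A n := by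
  obtain ⟨l, hl, hmem, hlim⟩ := exists_filter_sInter hch hne
  rw [hempty] at hlim
  simp only [Set.mem_empty_iff_false, iff_false] at hlim
  have hNfin : ∀ A ∈ 𝒞, (G.outerBoundary A).Finite := fun A hA =>
    Set.finite_of_encard_le_coe (hN A hA)
  -- The vertices that stay in or next to every member. Each is eventually in the outer boundary, so
  -- there are at most `k` of them; every other vertex is eventually neither in a member nor next to
  -- it.
  let W : Set V := {v | ∀ A ∈ 𝒞, v ∈ A ∪ G.outerBoundary A}
  have hWN : ∀ v ∈ W, ∀ᶠ A in l, v ∈ G.outerBoundary A := by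
    intro v hv
    filter_upwards [hmem, hlim v] with A hA hvA
    exact (hv A hA).resolve_left hvA
  have hW : W.encard ≤ k := encard_le_of_frequently hWN (hmem.mono fun A hA => hN A hA).frequently
  have hWfin : W.Finite := Set.finite_of_encard_le_coe hW
  have hdead : ∀ v, v ∉ W → ∀ᶠ A in l, v ∉ A ∪ G.outerBoundary A := by
    intro v hv
    simp only [W, Set.mem_ofPred_eq, not_forall] at hv
    obtain ⟨B, hB, hvB⟩ := hv
    obtain ⟨b, hb⟩ : ∃ b, b ∈ B := by
      obtain ⟨⟨b, hb⟩⟩ := (hconn B hB).nonempty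
      exact ⟨b, hb⟩
    filter_upwards [hmem, hlim b] with A hA hbA hvA
    rcases hch.total hA hB with h | h
    · exact hvB (outerBoundary_mono_union h hvA)
    · exact hbA (h hb)
  obtain ⟨A₀, hA₀, hWA₀⟩ : ∃ A ∈ 𝒞, ∀ v ∈ W, v ∉ A := by
    obtain ⟨A, h1, h2⟩ := (hmem.and ((Filter.eventually_all_finite hWfin).2
      fun v _ => hlim v)).exists
    exact ⟨A, h1, h2⟩
  have hstep : ∀ A : 𝒞, ∃ B : 𝒞, (B : Set V) ⊆ A ∧ (B : Set V) ≠ A ∧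
      ∀ v ∈ G.outerBoundary (A : Set V), v ∈ (B : Set V) ∪ G.outerBoundary (B : Set V) → v ∈ W := by
    rintro ⟨A, hA⟩
    obtain ⟨a, ha⟩ : ∃ b, b ∈ A := by
      obtain ⟨⟨b, hb⟩⟩ := (hconn A hA).nonempty
      exact ⟨b, hb⟩
    have hev : ∀ᶠ B in l, ∀ v ∈ G.outerBoundary A, v ∈ B ∪ G.outerBoundary B → v ∈ W := by
      refine (Filter.eventually_all_finite (hNfin A hA)).2 fun v _ => ?_
      by_cases hv : v ∈ W
      · exact Filter.Eventually.of_forall fun _ _ => hv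
      · exact (hdead v hv).mono fun B hB h => absurd h hB
    obtain ⟨B, ⟨hB, haB⟩, hB'⟩ := ((hmem.and (hlim a)).and hev).exists
    refine ⟨⟨B, hB⟩, ?_, ?_, hB'⟩
    · rcases hch.total hB hA with h | h
      · exact h
      · exact absurd (h ha) haB
    · rintro rfl
      exact haB ha
  choose next h1 h2 h3 using hstep
  let A : ℕ → 𝒞 := fun n => next^[n] ⟨A₀, hA₀⟩
  have hA : ∀ n, A (n + 1) = next (A n) := fun n => Function.iterate_succ_apply' next n _
  have hanti : Antitone fun n => (A n : Set V) := antitone_nat_of_succ_le fun n => by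
    rw [hA]
    exact h1 _
  refine ⟨fun n => A n, hanti, fun n => (A n).2, fun v => ?_⟩
  by_contra! hv
  -- A vertex of `A₀` outside the intersection but next to it would be an outer neighbour of all
  -- late members, hence in `W`, which `A₀` avoids. So a nonempty intersection would be all of `A₀`,
  -- although the sequence descends strictly.
  have hsub : A₀ ⊆ {x | ∀ n, x ∈ (A n : Set V)} := by
    refine subset_of_induce_connected (hconn A₀ hA₀) (hv 0) hv ?_
    intro x hx y hy hxy
    by_contra hcon
    obtain ⟨n, hn⟩ : ∃ n, y ∉ (A n : Set V) := by simpa using hcon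
    have hb : ∀ m, n ≤ m → y ∈ G.outerBoundary (A m : Set V) := fun m hm =>
      ⟨fun h => hn (hanti hm h), x, hx m, hxy⟩
    refine hWA₀ y (h3 (A n) y (hb n le_rfl) ?_) hy
    rw [← hA]
    exact Or.inr (hb _ (Nat.le_succ n))
  refine h2 (A 0) (Set.Subset.antisymm (h1 _) fun x hx => ?_)
  rw [← hA]
  exact hsub hx 1

/-- Below every set of a suitable family there is a minimal member of the family or a sequence of
members with empty intersection. -/
theorem exists_minimal_or_sequence {V : Type*} {G : SimpleGraph V} {P : Set V → Prop} {k : ℕ}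
    (hconn : ∀ A, P A → (G.induce A).Connected) (hN : ∀ A, P A → (G.outerBoundary A).encard ≤ k)
    (hlim : ∀ (l : Filter (Set V)) (I : Set V), l.NeBot → (∀ᶠ A in l, P A ∧ I ⊆ A) →
      (∀ y, ∀ᶠ A in l, (y ∈ A ↔ y ∈ I)) → I.Nonempty → ∃ B ⊆ I, P B) {A₀ : Set V} (hA₀ : P A₀) :
    (∃ A ⊆ A₀, P A ∧ ∀ B ⊆ A, P B → B = A) ∨
      ∃ A : ℕ → Set V, Antitone A ∧ A 0 ⊆ A₀ ∧ (∀ n, P (A n)) ∧ ∀ v, ∃ n, v ∉ A n := by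
  -- If every chain has nonempty intersection, `hlim` provides the lower bounds that Zorn's lemma
  -- needs; a chain with empty intersection gives the sequence instead.
  by_cases h : ∀ 𝒞 ⊆ {A | P A ∧ A ⊆ A₀}, IsChain (· ⊆ ·) 𝒞 → 𝒞.Nonempty → (⋂₀ 𝒞).Nonempty
  · left
    obtain ⟨A, hA, hmin⟩ := zorn_superset_nonempty {A | P A ∧ A ⊆ A₀} (fun 𝒞 h𝒞 hch hne => by
      obtain ⟨l, hl, hmem, hl'⟩ := exists_filter_sInter hch hne
      obtain ⟨B, hB, hPB⟩ := hlim l _ hl (hmem.mono fun A hA =>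
        ⟨(h𝒞 hA).1, Set.sInter_subset_of_mem hA⟩) hl' (h 𝒞 h𝒞 hch hne)
      obtain ⟨C, hC⟩ := hne
      exact ⟨B, ⟨hPB, hB.trans ((Set.sInter_subset_of_mem hC).trans (h𝒞 hC).2)⟩,
        fun s hs => hB.trans (Set.sInter_subset_of_mem hs)⟩) A₀ ⟨hA₀, subset_rfl⟩
    exact ⟨A, hA, hmin.1.1, fun B hB hPB =>
      Set.Subset.antisymm hB (hmin.2 ⟨hPB, hB.trans hA⟩ hB)⟩
  · right
    push Not at h
    obtain ⟨𝒞, h𝒞, hch, hne, hemp⟩ := h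
    obtain ⟨A, hA, hmem, hv⟩ := exists_vanishing_sequence hch hne (fun A hA => hconn A (h𝒞 hA).1)
      (fun A hA => hN A (h𝒞 hA).1) hemp
    exact ⟨A, hA, (h𝒞 (hmem 0)).2, fun n => (h𝒞 (hmem n)).1, hv⟩

theorem exists_minimal_or_end {V : Type*} {G : SimpleGraph V} {P : Set V → Prop} {k : ℕ}
    (hconn : ∀ A, P A → (G.induce A).Connected) (hN : ∀ A, P A → (G.outerBoundary A).encard ≤ k)
    (hlim : ∀ (l : Filter (Set V)) (I : Set V), l.NeBot → (∀ᶠ A in l, P A ∧ I ⊆ A) →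
      (∀ y, ∀ᶠ A in l, (y ∈ A ↔ y ∈ I)) → I.Nonempty → ∃ B ⊆ I, P B) {A₀ : Set V} (hA₀ : P A₀) :
    (∃ A ⊆ A₀, P A ∧ ∀ B ⊆ A, P B → B = A) ∨
      ∃ ω : G.Ends, ω ∈ G.endsSmallVertexDegree k ∧ LivesIn ω A₀ := by
  refine (exists_minimal_or_sequence hconn hN hlim hA₀).imp_right ?_
  rintro ⟨A, hanti, h0, hP, hv⟩
  obtain ⟨ω, hω⟩ := exists_end_livesIn hanti (fun n => hconn _ (hP n))
    (fun n => Set.finite_of_encard_le_coe (hN _ (hP n))) hv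
  exact ⟨ω, endVertexDegree_le hanti hv hω fun n => hN _ (hP n), (hω 0).mono h0⟩

/-! ### Mixed cuts and their submodularity -/

/-- Submodularity of mixed cuts. -/
theorem encard_cutPairs_uncross {V : Type*} (G : SimpleGraph V) {X A Y C : Set V} :
    (G.cutPairs ((X ∩ C) ∪ (X ∩ Y) ∪ (Y ∩ A)) (A ∩ C)).encard +
      (G.cutPairs ((X ∩ (C ∪ Y)ᶜ) ∪ (X ∩ Y) ∪ (Y ∩ (A ∪ X)ᶜ)) ((A ∪ X)ᶜ ∩ (C ∪ Y)ᶜ)).encard ≤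
      (G.cutPairs X A).encard + (G.cutPairs Y C).encard := by
  -- Pairs leaving the opposite corner are reversed, so that both corner cuts consist of pairs in
  -- the orientation of the cuts of `A` and `C`; union and intersection are then compared
  -- separately.
  rw [← Prod.swap_injective.encard_image (G.cutPairs _ ((A ∪ X)ᶜ ∩ (C ∪ Y)ᶜ)),
    ← Set.encard_union_add_encard_inter, ← Set.encard_union_add_encard_inter (G.cutPairs X A)]
  refine add_le_add (Set.encard_le_encard ?_) (Set.encard_le_encard ?_)
  · rintro ⟨a, b⟩ (⟨h1, h2, h3, h4⟩ | ⟨⟨b', a'⟩, ⟨h1, h2, h3, h4⟩, h⟩)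
    · simp only [cutPairs, Set.mem_union, Set.mem_inter_iff, Set.mem_ofPred_eq] at *
      tauto
    · obtain ⟨rfl, rfl⟩ := Prod.mk.inj h
      replace h4 := h4.symm
      simp only [cutPairs, Set.mem_union, Set.mem_inter_iff, Set.mem_ofPred_eq,
        Set.mem_compl_iff] at *
      tauto
  · rintro ⟨a, b⟩ ⟨⟨h1, h2, h3, h4⟩, ⟨⟨b', a'⟩, ⟨h5, h6, h7, h8⟩, h⟩⟩
    obtain ⟨rfl, rfl⟩ := Prod.mk.inj h
    simp only [cutPairs, Set.mem_union, Set.mem_inter_iff, Set.mem_ofPred_eq,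
      Set.mem_compl_iff] at *
    tauto

theorem encard_cutPairs_compl {V : Type*} (G : SimpleGraph V) {X A : Set V} (h : Disjoint X A) :
    (G.cutPairs X (A ∪ X)ᶜ).encard = (G.cutPairs X A).encard := by
  rw [← Prod.swap_injective.encard_image (G.cutPairs X A)]
  congr 1
  ext ⟨a, b⟩
  have h1 : a ∈ X → a ∉ A := fun h' => Set.disjoint_left.1 h h'
  have h2 : b ∈ X → b ∉ A := fun h' => Set.disjoint_left.1 h h'
  simp only [Set.image_swap_eq_preimage_swap, Set.mem_preimage, cutPairs, Set.mem_ofPred_eq,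
    Prod.fst_swap, Prod.snd_swap, Set.mem_compl_iff, Set.mem_union, G.adj_comm a b]
  tauto

theorem encard_cutPairs_component_le {V : Type*} {G : SimpleGraph V} {X A K : Set V} (hKA : K ⊆ A)
    (hcl : ∀ x ∈ K, ∀ y ∈ A, G.Adj x y → y ∈ K) :
    (G.cutPairs X K).encard ≤ (G.cutPairs X A).encard :=
  Set.encard_le_encard fun _ ⟨h1, h2, h3, h4⟩ => ⟨hKA h1, fun h => h2 (hcl _ h1 _ h h4), h3, h4⟩

theorem outerBoundary_component_subset {V : Type*} {G : SimpleGraph V} {A K : Set V} (hKA : K ⊆ A)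
    (hcl : ∀ x ∈ K, ∀ y ∈ A, G.Adj x y → y ∈ K) : G.outerBoundary K ⊆ G.outerBoundary A :=
  fun _ ⟨h1, x, hx, h⟩ => ⟨fun hy => h1 (hcl x hx _ hy h), x, hKA hx, h⟩

theorem encard_outerBoundary_le {V : Type*} {G : SimpleGraph V} (X A : Set V) :
    (G.outerBoundary A).encard ≤ X.encard + (G.cutPairs X A).encard := by
  have : G.outerBoundary A ⊆ X ∪ Prod.snd '' G.cutPairs X A := by
    rintro y ⟨hy, x, hx, hxy⟩
    by_cases hyX : y ∈ X
    · exact Or.inl hyX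
    · exact Or.inr ⟨(x, y), ⟨hx, hy, hyX, hxy⟩, rfl⟩
  exact (Set.encard_le_encard this).trans ((Set.encard_union_le _ _).trans
    (add_le_add le_rfl (Set.encard_image_le _ _)))

theorem outerBoundary_singleton {V : Type*} (G : SimpleGraph V) (v : V) :
    G.outerBoundary {v} = G.neighborSet v := by
  ext y
  simp only [outerBoundary, Set.mem_singleton_iff, Set.mem_ofPred_eq, exists_eq_left,
    mem_neighborSet, and_iff_right_iff_imp]
  rintro h rfl
  exact G.loopless.irrefl _ h

theorem IsEdgeConnected.le_encard_cutPairs {V : Type*} {G : SimpleGraph V} {k : ℕ}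
    (hG : G.IsEdgeConnected k) {A : Set V} {a b : V} (ha : a ∈ A) (hb : b ∉ A) :
    k ≤ (G.cutPairs ∅ A).encard := by
  by_contra hlt
  rw [not_le] at hlt
  refine hb (Reachable.mem_of_closed ?_ (hG a b ((Set.encard_image_le
    (fun p : V × V => s(p.1, p.2)) (G.cutPairs ∅ A)).trans_lt hlt)) ha)
  intro x hx y hxy
  rw [deleteEdges_adj] at hxy
  by_contra hy
  exact hxy.2 ⟨(x, y), ⟨hx, hy, id, hxy.1⟩, rfl⟩

theorem exists_cut_of_not_isEdgeConnected {V : Type*} {G : SimpleGraph V} {k : ℕ}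
    (hG : ¬ G.IsEdgeConnected k) : ∃ A : Set V, A.Nonempty ∧ Aᶜ.Nonempty ∧
      (G.cutPairs ∅ A).encard < k := by
  simp only [IsEdgeConnected, IsEdgeReachable, not_forall] at hG
  obtain ⟨u, v, s, hs, huv⟩ := hG
  refine ⟨{z | (G.deleteEdges s).Reachable u z}, ⟨u, Reachable.refl _⟩, ⟨v, huv⟩,
    lt_of_le_of_lt ?_ hs⟩
  have hinj : Set.InjOn (fun p : V × V => s(p.1, p.2))
      (G.cutPairs ∅ {z | (G.deleteEdges s).Reachable u z}) := by
    rintro ⟨a, b⟩ ⟨h1, h2, -⟩ ⟨c, d⟩ ⟨h3, h4, -⟩ h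
    rcases Sym2.eq_iff.1 h with ⟨rfl, rfl⟩ | ⟨rfl, rfl⟩
    · rfl
    · exact absurd h1 h4
  rw [← hinj.encard_image]
  refine Set.encard_le_encard ?_
  rintro _ ⟨⟨a, b⟩, ⟨h1, h2, -, h4⟩, rfl⟩
  by_contra hns
  exact h2 (h1.trans (Adj.reachable ((deleteEdges_adj).2 ⟨h4, hns⟩)))

/-- A vertex or an end lies in a set of vertices. -/
def LocatedIn {V : Type*} {G : SimpleGraph V} (z : V ⊕ G.Ends) (A : Set V) : Prop :=
  Sum.elim (fun v => v ∈ A) (fun ω => LivesIn ω A) z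

theorem LocatedIn.mono {V : Type*} {G : SimpleGraph V} {z : V ⊕ G.Ends} {A B : Set V}
    (h : LocatedIn z A) (hAB : A ⊆ B) : LocatedIn z B := by
  cases z with
  | inl v => exact hAB h
  | inr ω => exact LivesIn.mono h hAB

theorem LocatedIn.ne {V : Type*} {G : SimpleGraph V} {z z' : V ⊕ G.Ends} {A B : Set V}
    (h : LocatedIn z A) (h' : LocatedIn z' B) (hAB : Disjoint A B) : z ≠ z' := by
  rintro rfl
  cases z with
  | inl v => exact Set.disjoint_left.1 hAB h h'
  | inr ω => exact LivesIn.ne h h' hAB rfl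

theorem two_le_mk_of_ne {α : Type*} {S : Set α} {a b : α} (ha : a ∈ S) (hb : b ∈ S)
    (hab : a ≠ b) : 2 ≤ #S :=
  two_le_iff.2 ⟨⟨a, ha⟩, ⟨b, hb⟩, fun h => hab (congrArg Subtype.val h)⟩

theorem mem_smallVertices_of_encard_le {V : Type*} {G : SimpleGraph V} {v : V} {k : ℕ}
    (h : (G.neighborSet v).encard ≤ k) : v ∈ G.smallVertices k := by
  have hfin := Set.finite_of_encard_le_coe h
  refine ⟨hfin, ?_⟩
  rw [← hfin.cast_ncard_eq] at h
  exact_mod_cast h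

theorem encard_neighborSet_le {V : Type*} (G : SimpleGraph V) (X : Set V) (v : V) :
    (G.neighborSet v).encard ≤ X.encard + (G.cutPairs X {v}).encard := by
  rw [← outerBoundary_singleton]
  exact encard_outerBoundary_le X {v}

theorem exists_adj_of_induce_connected {V : Type*} {G : SimpleGraph V} {A : Set V}
    (hA : (G.induce A).Connected) {a b : V} (ha : a ∈ A) (hb : b ∈ A) (hab : a ≠ b) :
    ∃ c ∈ A, G.Adj a c := by
  by_contra! hcon
  have := subset_of_induce_connected hA ha (I := {a}) rfl (by
    rintro x rfl y hy hxy
    exact absurd hxy (hcon y hy))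
  exact hab (this hb).symm

/-! ### Edge-minimally `k`-edge-connected graphs -/

/-- A cut of `G - ab` with fewer than `k` edges must be crossed by `ab` in `G`, since `G` itself has
no such cut. Restoring `ab` adds one edge; the complement is taken if `b` lies on the chosen side.
-/
theorem IsEdgeMinKEdgeConnected.exists_cut {V : Type*} {G : SimpleGraph V} {k : ℕ}
    (hG : G.IsEdgeMinKEdgeConnected k) {a b : V} (hab : G.Adj a b) :
    ∃ C : Set V, a ∈ C ∧ b ∉ C ∧ (G.cutPairs ∅ C).encard ≤ k := by
  have h := hG.2 s(a, b) hab
  have hnot : ¬ (G.deleteEdges {s(a, b)}).IsEdgeConnected k := fun h' => h ⟨hG.1.1, h'⟩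
  obtain ⟨C, ⟨x, hx⟩, ⟨y, hy⟩, hC⟩ := exists_cut_of_not_isEdgeConnected hnot
  have hGC := hG.1.2.le_encard_cutPairs hx hy
  have hsub : ∀ p : V × V, p ∈ G.cutPairs ∅ C → p.1 = a ∧ p.2 = b ∨ p.1 = b ∧ p.2 = a ∨
      p ∈ (G.deleteEdges {s(a, b)}).cutPairs ∅ C := by
    rintro ⟨u, v⟩ ⟨h1, h2, h3, h4⟩
    by_cases he : s(u, v) = s(a, b)
    · rcases Sym2.eq_iff.1 he with h | h
      · exact Or.inl h
      · exact Or.inr (Or.inl h)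
    · exact Or.inr (Or.inr ⟨h1, h2, h3, by
        rw [deleteEdges_adj]
        exact ⟨h4, he⟩⟩)
  have key : ∀ q : V × V, (∀ p ∈ G.cutPairs ∅ C, p = q ∨
      p ∈ (G.deleteEdges {s(a, b)}).cutPairs ∅ C) → (G.cutPairs ∅ C).encard ≤ k := by
    intro q hq
    have : G.cutPairs ∅ C ⊆ insert q ((G.deleteEdges {s(a, b)}).cutPairs ∅ C) := fun p hp => hq p hp
    exact (Set.encard_le_encard this).trans ((Set.encard_insert_le _ _).trans
      (Order.add_one_le_of_lt hC))
  by_cases haC : a ∈ C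
  · by_cases hbC : b ∈ C
    · exfalso
      refine absurd (hGC.trans (Set.encard_le_encard fun p hp => ?_)) (not_le.2 hC)
      rcases hsub p hp with h | h | h
      · exact absurd (h.2 ▸ hbC) hp.2.1
      · exact absurd (h.2 ▸ haC) hp.2.1
      · exact h
    · refine ⟨C, haC, hbC, key (a, b) fun p hp => ?_⟩
      rcases hsub p hp with h | h | h
      · exact Or.inl (Prod.ext h.1 h.2)
      · exact absurd (h.1 ▸ hp.1) hbC
      · exact Or.inr h
  · by_cases hbC : b ∈ C
    · have := key (b, a) fun p hp => by
        rcases hsub p hp with h | h | h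
        · exact absurd (h.1 ▸ hp.1) haC
        · exact Or.inl (Prod.ext h.1 h.2)
        · exact Or.inr h
      refine ⟨Cᶜ, haC, fun h => h hbC, ?_⟩
      have h2 := G.encard_cutPairs_compl (Set.empty_disjoint C)
      rw [Set.union_empty] at h2
      rwa [h2]
    · exfalso
      refine absurd (hGC.trans (Set.encard_le_encard fun p hp => ?_)) (not_le.2 hC)
      rcases hsub p hp with h | h | h
      · exact absurd (h.1 ▸ hp.1) haC
      · exact absurd (h.1 ▸ hp.1) hbC
      · exact h

theorem ENat.le_of_add_le_add_of_le {a b c d : ℕ∞} (h : a + b ≤ c + d) (hd : d ≤ b) (hd' : d ≠ ⊤) :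
    a ≤ c :=
  (ENat.add_le_add_iff_right hd').1 ((add_le_add le_rfl hd).trans h)

/-- By submodularity: the opposite corner contains `y` and so takes at least `k` of the at most `2 *
k` edges. -/
theorem IsEdgeConnected.encard_cutPairs_inter_le {V : Type*} {G : SimpleGraph V} {k : ℕ}
    (hG : G.IsEdgeConnected k) {A C : Set V} (hA : (G.cutPairs ∅ A).encard ≤ k)
    (hC : (G.cutPairs ∅ C).encard ≤ k) {a : V} (ha : a ∈ A) {y : V} (hyA : y ∉ A) (hyC : y ∉ C) :
    (G.cutPairs ∅ (A ∩ C)).encard ≤ k := by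
  have h := G.encard_cutPairs_uncross (X := ∅) (A := A) (Y := ∅) (C := C)
  simp only [Set.empty_inter, Set.union_empty] at h
  have h2 := hG.le_encard_cutPairs (A := Aᶜ ∩ Cᶜ) (a := y) (b := a) ⟨hyA, hyC⟩ fun h => h.1 ha
  exact ENat.le_of_add_le_add_of_le (h.trans (add_le_add hA hC)) h2 (ENat.natCast_ne_top k)

/-- Connected sets that span a cut of at most `k` edges. -/
def IsCutSide {V : Type*} (G : SimpleGraph V) (k : ℕ) (A : Set V) : Prop :=
  (G.induce A).Connected ∧ Aᶜ.Nonempty ∧ (G.cutPairs ∅ A).encard ≤ k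

theorem exists_isCutSide {V : Type*} {G : SimpleGraph V} {k : ℕ} {A : Set V} (hA : A.Nonempty)
    (hA' : Aᶜ.Nonempty) (hk : (G.cutPairs ∅ A).encard ≤ k) : ∃ K ⊆ A, G.IsCutSide k K := by
  obtain ⟨a, ha⟩ := hA
  obtain ⟨K, hKA, -, hK, hcl⟩ := G.exists_component ha
  exact ⟨K, hKA, hK, hA'.mono (Set.compl_subset_compl.2 hKA),
    (encard_cutPairs_component_le hKA hcl).trans hk⟩

theorem IsEdgeMinKEdgeConnected.exists_small {V : Type*} {G : SimpleGraph V} {k : ℕ}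
    (hG : G.IsEdgeMinKEdgeConnected k) {A₀ : Set V} (hA₀ : G.IsCutSide k A₀) :
    ∃ z ∈ G.vertexEndUnion (G.smallVertices k) (G.endsSmallEdgeDegree k), LocatedIn z A₀ := by
  have hN : ∀ A, G.IsCutSide k A → (G.outerBoundary A).encard ≤ k := fun A hA => by
    have := encard_outerBoundary_le (G := G) ∅ A
    rw [Set.encard_empty, zero_add] at this
    exact this.trans hA.2.2
  have hlim : ∀ (l : Filter (Set V)) (I : Set V), l.NeBot → (∀ᶠ A in l, G.IsCutSide k A ∧ I ⊆ A) →
      (∀ y, ∀ᶠ A in l, (y ∈ A ↔ y ∈ I)) → I.Nonempty → ∃ B ⊆ I, G.IsCutSide k B := by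
    intro l I hl hP hlI hne
    obtain ⟨A, hA, hIA⟩ := hP.exists
    exact exists_isCutSide hne (hA.2.1.mono (Set.compl_subset_compl.2 hIA))
      (encard_le_of_frequently (eventually_mem_cutPairs hlI ∅)
        (hP.mono fun A hA => hA.1.2.2).frequently)
  rcases exists_minimal_or_sequence (k := k) (fun A hA => hA.1) hN hlim hA₀ with
    ⟨A, hAA₀, hA, hmin⟩ | ⟨A, hanti, h0, hP, hv⟩
  · obtain ⟨⟨a, ha⟩⟩ := hA.1.nonempty
    obtain ⟨y, hy⟩ := hA.2.1
    -- An edge inside `A` lies in a cut of at most `k` edges. The side of it that misses the outside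
    -- vertex `y` meets `A` in a smaller set with a cut of at most `k` edges, against minimality.
    have hsing : A = {a} := by
      by_contra hne
      obtain ⟨b, hb, hab⟩ : ∃ b ∈ A, b ≠ a := by
        by_contra! h
        exact hne (Set.eq_singleton_iff_unique_mem.2 ⟨ha, h⟩)
      obtain ⟨c, hc, hac⟩ := exists_adj_of_induce_connected hA.1 ha hb hab.symm
      have hcut : ∀ C : Set V, (A ∩ C).Nonempty → (A ∩ Cᶜ).Nonempty → (∃ z, z ∉ A ∧ z ∉ C) →
          (G.cutPairs ∅ C).encard ≤ k → False := by
        rintro C h1 ⟨u, huA, huC⟩ ⟨z, hzA, hzC⟩ hC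
        obtain ⟨K, hK, hK'⟩ := exists_isCutSide h1 ⟨u, fun h => huC h.2⟩
          (hG.1.2.encard_cutPairs_inter_le hA.2.2 hC ha hzA hzC)
        have := hmin K (hK.trans Set.inter_subset_left) hK'
        exact huC (hK (this ▸ huA)).2
      obtain ⟨C, haC, hcC, hC⟩ := hG.exists_cut hac
      by_cases hyC : y ∈ C
      · have h2 := G.encard_cutPairs_compl (Set.empty_disjoint C)
        rw [Set.union_empty] at h2
        exact hcut Cᶜ ⟨c, hc, hcC⟩ ⟨a, ha, fun h => h haC⟩ ⟨y, hy, fun h => h hyC⟩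
          (h2.trans_le hC)
      · exact hcut C ⟨a, ha, haC⟩ ⟨c, hc, hcC⟩ ⟨y, hy, hyC⟩ hC
    refine ⟨Sum.inl a, Or.inl ⟨a, mem_smallVertices_of_encard_le ?_, rfl⟩, hAA₀ ha⟩
    rw [← outerBoundary_singleton, ← hsing]
    exact hN A hA
  · obtain ⟨ω, hω⟩ := exists_end_livesIn hanti (fun n => (hP n).1)
      (fun n => Set.finite_of_encard_le_coe (hN _ (hP n))) hv
    exact ⟨Sum.inr ω, Or.inr ⟨ω, endEdgeDegree_le hanti hv hω fun n => (hP n).2.2, rfl⟩,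
      (hω 0).mono h0⟩

theorem IsEdgeMinKEdgeConnected.two_le {V : Type*} {G : SimpleGraph V} {k : ℕ} (hk : 1 ≤ k)
    (hG : G.IsEdgeMinKEdgeConnected k) :
    2 ≤ #(G.vertexEndUnion (G.smallVertices k) (G.endsSmallEdgeDegree k)) := by
  have := hG.1.1
  obtain ⟨a, b, hab⟩ := exists_pair_ne V
  obtain ⟨c, hc, -⟩ := exists_closer_neighbor (hG.1.2.preconnected (by omega)) hab
  obtain ⟨C, ha, hc, hC⟩ := hG.exists_cut hc
  have h2 := G.encard_cutPairs_compl (Set.empty_disjoint C)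
  rw [Set.union_empty] at h2
  obtain ⟨K, hKC, hK⟩ := exists_isCutSide ⟨a, ha⟩ ⟨c, hc⟩ hC
  obtain ⟨L, hLC, hL⟩ := exists_isCutSide (A := Cᶜ) ⟨c, hc⟩ ⟨a, fun h => h ha⟩ (h2.trans_le hC)
  obtain ⟨z, hz, hz'⟩ := hG.exists_small hK
  obtain ⟨w, hw, hw'⟩ := hG.exists_small hL
  exact two_le_mk_of_ne hz hw (LocatedIn.ne hz' hw'
    (Set.disjoint_of_subset hKC hLC disjoint_compl_right))

/-! ### Trees -/

theorem IsEdgeMinKConnected.isEdgeMinKEdgeConnected_one {V : Type*} {G : SimpleGraph V}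
    (hG : G.IsEdgeMinKConnected 1) : G.IsEdgeMinKEdgeConnected 1 := by
  have key : ∀ H : SimpleGraph V, H.IsKEdgeConnected 1 ↔ H.IsKConnected 1 := by
    intro H
    have h1 : Nontrivial V ↔ ((1 : ℕ) : Cardinal) < #V := by
      rw [Nat.cast_one, one_lt_iff_nontrivial]
    rw [IsKEdgeConnected, IsKConnected, h1, isEdgeConnected_one]
    refine and_congr_right fun hV => ?_
    have : Nontrivial V := h1.2 hV
    have h2 : ∀ X : Set V, X.encard < (1 : ℕ) ↔ X = ∅ := fun X => by
      rw [Nat.cast_one, Order.lt_one_iff, Set.encard_eq_zero]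
    simp only [h2, forall_eq]
    rw [Set.compl_empty, (induceUnivIso H).connected_iff, connected_iff]
    exact ⟨fun h => ⟨h, inferInstance⟩, fun h => h.1⟩
  exact ⟨(key G).2 hG.1, fun e he h => hG.2 e he ((key _).1 h)⟩

theorem IsEdgeMinKEdgeConnected.exists_bridge_side {V : Type*} {G : SimpleGraph V}
    (hG : G.IsEdgeMinKEdgeConnected 1) {a b : V} (hab : G.Adj a b) :
    ∃ C : Set V, a ∈ C ∧ b ∉ C ∧ ∀ x ∈ C, ∀ y, y ∉ C → G.Adj x y → x = a ∧ y = b := by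
  obtain ⟨C, ha, hb, hC⟩ := hG.exists_cut hab
  refine ⟨C, ha, hb, fun x hx y hy hxy => ?_⟩
  have := Set.encard_le_one_iff.1 hC (x, y) (a, b) ⟨hx, hy, id, hxy⟩ ⟨ha, hb, id, hab⟩
  exact Prod.ext_iff.1 this

/-- Each edge of the ray is a bridge, and the sides of these bridges that contain the tails form a
vanishing sequence whose cuts are single edges. -/
theorem IsEdgeMinKEdgeConnected.endEdgeDegree_toEnd_le_one {V : Type*} {G : SimpleGraph V}
    (hG : G.IsEdgeMinKEdgeConnected 1) (r : G.Ray) : endEdgeDegree r.toEnd ≤ (1 : ℕ) := by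
  have hpre : G.Preconnected := hG.1.2.preconnected one_ne_zero
  choose A h1 h2 h3 using fun n => hG.exists_bridge_side (r.adj n).symm
  have htail : ∀ n i, n + 1 ≤ i → r.toFun i ∈ A n := by
    intro n i hi
    induction i, hi using Nat.le_induction with
    | base => exact h1 n
    | succ i hi ih =>
      by_contra hcon
      have := r.inj (h3 n _ ih _ hcon (r.adj i)).2
      omega
  have hhead : ∀ n d, r.toFun (n - d) ∉ A n := by
    intro n d
    induction d with
    | zero => exact h2 n
    | succ d ih =>
      intro hcon
      by_cases hd : n - d = 0
      · exact ih (by rwa [show n - d = n - (d + 1) by omega])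
      · rw [show n - d = n - (d + 1) + 1 by omega] at ih
        have := r.inj (h3 n _ hcon _ ih (r.adj _)).1
        omega
  have hhead' : ∀ n i, i ≤ n → r.toFun i ∉ A n := fun n i hi => by
    have := hhead n (n - i)
    rwa [Nat.sub_sub_self hi] at this
  have hanti : Antitone A := antitone_nat_of_succ_le fun n x hx => by
    by_contra hxn
    refine hhead' (n + 1) n (Nat.le_succ n) (Reachable.mem_of_closed
      (S := {z | z ∈ A (n + 1) ∧ z ∉ A n}) ?_ (hpre x (r.toFun n)) ⟨hx, hxn⟩).1
    rintro a ⟨ha, ha'⟩ b hab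
    have hb' : b ∈ A (n + 1) := by
      by_contra hb
      exact ha' ((h3 _ _ ha _ hb hab).1 ▸ htail n _ (by omega))
    refine ⟨hb', fun hb => hhead' (n + 1) (n + 1) le_rfl ?_⟩
    rwa [← (h3 _ _ hb _ ha' hab.symm).1]
  -- An edge leaving the intersection would leave two successive sides, hence be two different edges
  -- of the ray.
  have hempty : ∀ v, ∃ n, v ∉ A n := by
    intro v
    by_contra! hv
    refine hhead' 0 0 le_rfl (Reachable.mem_of_closed (S := {z | ∀ n, z ∈ A n}) ?_
      (hpre v (r.toFun 0)) hv 0)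
    intro x hx y hxy
    by_contra hy
    obtain ⟨n, hn⟩ : ∃ n, y ∉ A n := by simpa using hy
    have e1 := (h3 n x (hx n) y hn hxy).1
    have e2 := (h3 (n + 1) x (hx _) y (fun h => hn (hanti (Nat.le_succ n) h)) hxy).1
    have := r.inj (e1.symm.trans e2)
    omega
  have hcut : ∀ n, (G.cutPairs ∅ (A n)).encard ≤ (1 : ℕ) := by
    intro n
    rw [Nat.cast_one, Set.encard_le_one_iff]
    rintro ⟨a, b⟩ ⟨c, d⟩ ⟨ha, hb, -, hab⟩ ⟨hc, hd, -, hcd⟩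
    obtain ⟨rfl, rfl⟩ := h3 n a ha b hb hab
    obtain ⟨rfl, rfl⟩ := h3 n c hc d hd hcd
    rfl
  refine endEdgeDegree_le hanti hempty (fun n => r.livesIn_toEnd ?_ ⟨n + 1, htail n⟩) hcut
  have := encard_outerBoundary_le (G := G) ∅ (A n)
  rw [Set.encard_empty, zero_add] at this
  exact Set.finite_of_encard_le_coe (this.trans (hcut n))

/-- A shortest path from `y` to `o` leaves `C` through `u`. -/
theorem eq_or_dist_lt_of_cut_vertex {V : Type*} {G : SimpleGraph V} (hpre : G.Preconnected)
    {C : Set V} {u o : V} (hC : ∀ x ∈ C, ∀ y, y ∉ C → G.Adj x y → x = u) (ho : o ∉ C) {y : V}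
    (hy : y ∈ C) : y = u ∨ G.dist o u < G.dist o y := by
  induction hd : G.dist o y using Nat.strong_induction_on generalizing y with
  | _ d ih =>
    subst hd
    obtain ⟨z, hz, hlt⟩ := exists_closer_neighbor hpre (u := y) (t := o) (by rintro rfl; exact ho hy)
    rw [dist_comm, G.dist_comm (u := y)] at hlt
    by_cases hzC : z ∈ C
    · rcases ih _ hlt hzC rfl with rfl | h
      · exact Or.inr hlt
      · exact Or.inr (h.trans hlt)
    · exact Or.inl (hC y hy z hzC hz)

/-- The bridge `uw` has `o` on the side of `w`, because `w` is not farther from `o` than `u`. Every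
other neighbour of `u` lies behind `u` and is strictly farther away. -/
theorem IsEdgeMinKEdgeConnected.parent_unique {V : Type*} {G : SimpleGraph V}
    (hG : G.IsEdgeMinKEdgeConnected 1) {o u w w' : V} (hw : G.Adj u w) (hw' : G.Adj u w')
    (hd : G.dist o w ≤ G.dist o u) (hd' : G.dist o w' ≤ G.dist o u) : w' = w := by
  have hpre : G.Preconnected := hG.1.2.preconnected one_ne_zero
  obtain ⟨C, hu, hwC, hC⟩ := hG.exists_bridge_side hw
  have ho : o ∉ C := by
    intro ho
    have hC' : ∀ x ∈ Cᶜ, ∀ y, y ∉ Cᶜ → G.Adj x y → x = w := fun x hx y hy hxy =>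
      (hC y (not_not.1 hy) x hx hxy.symm).2
    obtain ⟨z, hz, hlt⟩ := exists_closer_neighbor hpre (u := w) (t := o) (by
      rintro rfl
      exact hwC ho)
    rw [dist_comm, G.dist_comm (u := w)] at hlt
    by_cases hzC : z ∈ C
    · rw [(hC z hzC w hwC hz.symm).1] at hlt
      omega
    · rcases eq_or_dist_lt_of_cut_vertex hpre hC' (not_not.2 ho) (y := z) hzC with h | h
      · exact G.loopless.irrefl _ (h ▸ hz)
      · omega
  by_contra hne
  have hw'C : w' ∈ C := by
    by_contra h
    exact hne (hC u hu w' h hw').2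
  rcases eq_or_dist_lt_of_cut_vertex hpre (fun x hx y hy hxy => (hC x hx y hy hxy).1) ho hw'C
    with h | h
  · exact G.loopless.irrefl _ (h ▸ hw')
  · omega

theorem IsEdgeMinKEdgeConnected.ends_subset {V : Type*} {G : SimpleGraph V}
    (hG : G.IsEdgeMinKEdgeConnected 1) (ω : G.Ends) : ω ∈ G.endsSmallEdgeDegree 1 := by
  obtain ⟨r, rfl⟩ := Quotient.exists_rep ω
  exact hG.endEdgeDegree_toEnd_le_one r

/-- Disjoint equivalent rays would give the end edge-degree at least two. -/
theorem IsEdgeMinKEdgeConnected.exists_common_vertex {V : Type*} {G : SimpleGraph V}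
    (hG : G.IsEdgeMinKEdgeConnected 1) {r s : G.Ray} (hrs : r.toEnd = s.toEnd) :
    ∃ i j, r.toFun i = s.toFun j := by
  by_contra! hcon
  have hne : r ≠ s := by
    rintro rfl
    exact hcon 0 0 rfl
  have hdisj : Disjoint r.edges s.edges := by
    rw [Set.disjoint_left]
    rintro _ ⟨i, rfl⟩ ⟨j, hj⟩
    rcases Sym2.eq_iff.1 hj with ⟨h, -⟩ | ⟨h, -⟩
    · exact hcon _ _ h.symm
    · exact hcon _ _ h.symm
  have h1 : #({r, s} : Set G.Ray) ≤ endEdgeDegree s.toEnd :=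
    le_ciSup (f := fun R : {R : Set G.Ray // (∀ r ∈ R, r.toEnd = s.toEnd) ∧
      R.PairwiseDisjoint Ray.edges} => #R.1) (bddAbove_of_small) ⟨{r, s}, by
        rintro t (rfl | rfl)
        · exact hrs
        · rfl, by
        rintro t (rfl | rfl) t' (rfl | rfl) htt'
        · exact absurd rfl htt'
        · exact hdisj
        · exact hdisj.symm
        · exact absurd rfl htt'⟩
  have h2 := h1.trans (hG.endEdgeDegree_toEnd_le_one s)
  have h3 : 2 ≤ #({r, s} : Set G.Ray) :=
    two_le_mk_of_ne (Set.mem_insert _ _) (Set.mem_insert_of_mem _ rfl) hne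
  have h4 := h3.trans h2
  norm_num at h4

theorem mk_le_of_countable_fibers.{u} {α β : Type u} (f : α → β) (hf : ∀ b, Countable {a // f a = b})
    (hα : ℵ₀ < #α) : #α ≤ #β := by
  have h1 : #α ≤ #β * ℵ₀ := by
    rw [← mk_congr (Equiv.sigmaFiberEquiv f), mk_sigma, ← sum_const']
    exact sum_le_sum _ _ fun b => mk_le_aleph0_iff.2 (hf b)
  rcases le_total #β ℵ₀ with h | h
  · exact absurd (h1.trans (mul_le_mul' h le_rfl)) (by rw [aleph0_mul_aleph0]; exact not_le.2 hα)
  · rwa [mul_aleph0_eq h] at h1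

theorem IsEdgeMinKEdgeConnected.mk_le {V : Type*} {G : SimpleGraph V}
    (hG : G.IsEdgeMinKEdgeConnected 1) (hV : ℵ₀ < #V) :
    #V ≤ #(G.vertexEndUnion (G.smallVertices 1) (G.endsSmallEdgeDegree 1)) := by
  classical
  have hpre : G.Preconnected := hG.1.2.preconnected one_ne_zero
  have := hG.1.1
  obtain ⟨o⟩ : Nonempty V := inferInstance
  have hnext : ∀ u, ∃ w, (∃ x, G.Adj u x ∧ G.dist o u < G.dist o x) →
      G.Adj u w ∧ G.dist o u < G.dist o w := fun u => by
    by_cases h : ∃ x, G.Adj u x ∧ G.dist o u < G.dist o x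
    · obtain ⟨x, hx⟩ := h
      exact ⟨x, fun _ => hx⟩
    · exact ⟨u, fun h' => absurd h' h⟩
  have hpar : ∀ u, ∃ w, (∃ x, G.Adj u x ∧ G.dist o x < G.dist o u) →
      G.Adj u w ∧ G.dist o w < G.dist o u := fun u => by
    by_cases h : ∃ x, G.Adj u x ∧ G.dist o x < G.dist o u
    · obtain ⟨x, hx⟩ := h
      exact ⟨x, fun _ => hx⟩
    · exact ⟨u, fun h' => absurd h' h⟩
  choose next hnext using hnext
  choose par hpar using hpar
  -- `next` climbs away from the root `o`, `par` descends towards it. A vertex from which no climb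
  -- is possible has only its parent as neighbour.
  let Stuck : V → Prop := fun u => ¬ ∃ x, G.Adj u x ∧ G.dist o u < G.dist o x
  have hparnext : ∀ u, ¬ Stuck u → par (next u) = u := fun u hu => by
    have h1 := hnext u (not_not.1 hu)
    have h2 := hpar (next u) ⟨u, h1.1.symm, h1.2⟩
    exact hG.parent_unique h1.1.symm h2.1 h1.2.le h2.2.le
  have hiter : ∀ v j, (∀ i < j, ¬ Stuck (next^[i] v)) → par^[j] (next^[j] v) = v := by
    intro v j
    induction j with
    | zero => exact fun _ => rfl
    | succ j ih =>
      intro h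
      rw [Function.iterate_succ_apply, Function.iterate_succ_apply' next,
        hparnext _ (h j (Nat.lt_succ_self j))]
      exact ih fun i hi => h i (hi.trans (Nat.lt_succ_self j))
  have hsmall : ∀ u, Stuck u → u ∈ G.smallVertices 1 := fun u hu => by
    have h : (G.neighborSet u).encard ≤ (1 : ℕ) := by
      rw [Nat.cast_one, Set.encard_le_one_iff]
      intro a b ha hb
      simp only [Stuck, not_exists, not_and, not_lt] at hu
      exact hG.parent_unique (o := o) hb ha (hu b hb) (hu a ha)
    simpa using mem_smallVertices_of_encard_le h
  -- `Rel v z` says that `v` is reached from the leaf `z`, or from every vertex of some ray of the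
  -- end `z`, by descending. As rays of one end share a vertex, descents from a single fixed ray
  -- reach all such `v`: countably many.
  let Rel : V → V ⊕ G.Ends → Prop := fun v z => Sum.elim (fun u => ∃ j, par^[j] u = v)
    (fun ω => ∃ r : G.Ray, r.toEnd = ω ∧ ∀ i, ∃ j, par^[j] (r.toFun i) = v) z
  have hex : ∀ v, ∃ z : G.vertexEndUnion (G.smallVertices 1) (G.endsSmallEdgeDegree 1),
      Rel v z := by
    intro v
    by_cases h : ∃ i, Stuck (next^[i] v)
    · exact ⟨⟨Sum.inl (next^[Nat.find h] v), Or.inl ⟨_, hsmall _ (Nat.find_spec h), rfl⟩⟩,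
        Nat.find h, hiter v _ fun i hi => Nat.find_min h hi⟩
    · have hns : ∀ i, ¬ Stuck (next^[i] v) := fun i hi => h ⟨i, hi⟩
      have hstep : ∀ i, G.Adj (next^[i] v) (next^[i + 1] v) ∧
          G.dist o (next^[i] v) < G.dist o (next^[i + 1] v) := fun i => by
        rw [Function.iterate_succ_apply']
        exact hnext _ (not_not.1 (hns i))
      let r : G.Ray := ⟨fun i => next^[i] v, fun i j hij =>
        (strictMono_nat_of_lt_succ fun i => (hstep i).2).injective
          (congrArg (G.dist o) hij : G.dist o (next^[i] v) = G.dist o (next^[j] v)),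
        fun i => (hstep i).1⟩
      exact ⟨⟨Sum.inr r.toEnd, Or.inr ⟨_, hG.ends_subset _, rfl⟩⟩, r, rfl,
        fun i => ⟨i, hiter v i fun j _ => hns j⟩⟩
  choose f hf using hex
  refine mk_le_of_countable_fibers f (fun z => ?_) hV
  suffices h : {v | Rel v z}.Countable by
    exact (h.mono (fun v (hv : f v = z) => show Rel v z from hv ▸ hf v)).to_subtype
  obtain ⟨z, -⟩ := z
  cases z with
  | inl u => exact Set.countable_range fun j => par^[j] u
  | inr ω =>
    by_cases hne : ∃ r₀ : G.Ray, r₀.toEnd = ω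
    · obtain ⟨r₀, rfl⟩ := hne
      refine (Set.countable_range fun p : ℕ × ℕ => par^[p.1] (r₀.toFun p.2)).mono ?_
      rintro v ⟨r, hr, hv⟩
      obtain ⟨i, j, hij⟩ := hG.exists_common_vertex hr
      obtain ⟨m, hm⟩ := hv i
      exact ⟨(m, j), by rw [← hm, hij]⟩
    · refine Set.countable_empty.mono ?_
      rintro v ⟨r, hr, -⟩
      exact hne ⟨r, hr⟩

theorem IsEdgeMinKConnected.vertexEndUnion_one {V : Type*} {G : SimpleGraph V}
    (hG : G.IsEdgeMinKConnected 1) :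
    (ℵ₀ < #V →
        #V ≤ #(G.vertexEndUnion (G.smallVertices 1) (G.endsSmallEdgeDegree 1)) ∧
        (#G.Ends ≤ #V →
          #(G.vertexEndUnion (G.smallVertices 1) (G.endsSmallEdgeDegree 1)) = #V)) ∧
      (#V ≤ ℵ₀ →
        2 ≤ #(G.vertexEndUnion (G.smallVertices 1) (G.endsSmallEdgeDegree 1))) := by
  have hG' := hG.isEdgeMinKEdgeConnected_one
  refine ⟨fun hV => ⟨hG'.mk_le hV, fun hE => (hG'.mk_le hV).antisymm' ?_⟩, fun _ => ?_⟩
  · refine (mk_set_le _).trans ?_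
    rw [mk_sum, lift_id, lift_id]
    exact (add_le_add le_rfl hE).trans (add_eq_self hV.le).le
  · simpa using hG'.two_le le_rfl

/-! ### Vertex-minimally `k`-edge-connected graphs: optimal cuts of `G - v` -/

/-- `A` is a side of an edge cut of `G - v` with fewer than `k` edges, of minimum size among the
edge cuts of `G - v`. -/
def IsOptCut {V : Type*} (G : SimpleGraph V) (k : ℕ) (v : V) (A : Set V) : Prop :=
  v ∉ A ∧ A.Nonempty ∧ (∃ z, z ∉ A ∧ z ≠ v) ∧ (G.cutPairs {v} A).encard < k ∧
    ∀ B : Set V, v ∉ B → B.Nonempty → (∃ z, z ∉ B ∧ z ≠ v) →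
      (G.cutPairs {v} A).encard ≤ (G.cutPairs {v} B).encard

theorem exists_isOptCut {V : Type*} {G : SimpleGraph V} {k : ℕ} {v : V}
    (h : ∃ A : Set V, v ∉ A ∧ A.Nonempty ∧ (∃ z, z ∉ A ∧ z ≠ v) ∧
      (G.cutPairs {v} A).encard < k) : ∃ A, G.IsOptCut k v A := by
  let S : Set (Set V) := {A | v ∉ A ∧ A.Nonempty ∧ (∃ z, z ∉ A ∧ z ≠ v)}
  obtain ⟨A₁, h1, h2, h3, h4⟩ := h
  obtain ⟨A, hA, hmin⟩ := WellFounded.has_min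
    (InvImage.wf (fun A : Set V => (G.cutPairs {v} A).encard) wellFounded_lt) S ⟨A₁, h1, h2, h3⟩
  have hmin' : ∀ B ∈ S, (G.cutPairs {v} A).encard ≤ (G.cutPairs {v} B).encard :=
    fun B hB => not_lt.1 (hmin B hB)
  exact ⟨A, hA.1, hA.2.1, hA.2.2, (hmin' A₁ ⟨h1, h2, h3⟩).trans_lt h4,
    fun B hB1 hB2 hB3 => hmin' B ⟨hB1, hB2, hB3⟩⟩

theorem IsOptCut.of_le {V : Type*} {G : SimpleGraph V} {k : ℕ} {v : V} {A B : Set V}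
    (hA : G.IsOptCut k v A) (hv : v ∉ B) (hB : B.Nonempty) (hB' : ∃ z, z ∉ B ∧ z ≠ v)
    (hle : (G.cutPairs {v} B).encard ≤ (G.cutPairs {v} A).encard) : G.IsOptCut k v B :=
  ⟨hv, hB, hB', hle.trans_lt hA.2.2.2.1,
    fun C h1 h2 h3 => hle.trans (hA.2.2.2.2 C h1 h2 h3)⟩

theorem IsOptCut.compl {V : Type*} {G : SimpleGraph V} {k : ℕ} {v : V} {A : Set V}
    (hA : G.IsOptCut k v A) : G.IsOptCut k v (A ∪ {v})ᶜ := by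
  obtain ⟨z, hz, hzv⟩ := hA.2.2.1
  obtain ⟨a, ha⟩ := hA.2.1
  refine hA.of_le (fun h => h (Or.inr rfl)) ⟨z, fun h => h.elim hz hzv⟩
    ⟨a, fun h => h (Or.inl ha), ?_⟩ (G.encard_cutPairs_compl ?_).le
  · rintro rfl
    exact hA.1 ha
  · exact Set.disjoint_singleton_left.2 hA.1

theorem IsOptCut.component {V : Type*} {G : SimpleGraph V} {k : ℕ} {v : V} {A : Set V}
    (hA : G.IsOptCut k v A) : ∃ K ⊆ A, (G.induce K).Connected ∧ G.IsOptCut k v K := by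
  obtain ⟨a, ha⟩ := hA.2.1
  obtain ⟨K, hKA, haK, hK, hcl⟩ := G.exists_component ha
  obtain ⟨z, hz, hzv⟩ := hA.2.2.1
  exact ⟨K, hKA, hK, hA.of_le (fun h => hA.1 (hKA h)) ⟨a, haK⟩ ⟨z, fun h => hz (hKA h), hzv⟩
    (encard_cutPairs_component_le hKA hcl)⟩

/-- A limit of optimal cuts is an optimal cut. -/
theorem IsOptCut.limit {V : Type*} {G : SimpleGraph V} {k : ℕ} (hG : G.IsEdgeConnected k)
    {Q : Set V} {l : Filter (Set V)} [l.NeBot] {I : Set V}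
    (hl : ∀ y, ∀ᶠ A in l, (y ∈ A ↔ y ∈ I)) (hP : ∀ᶠ A in l, ∃ x ∈ Q, G.IsOptCut k x A)
    (hne : I.Nonempty)
    (hne' : ∀ᶠ A in l, ∀ x ∈ Q, G.IsOptCut k x A → ∃ z, z ∉ I ∧ z ≠ x) : ∃ x ∈ Q, G.IsOptCut k x I := by
  -- If some `x` serves frequently, minimality of the cut size passes to the limit. Otherwise every
  -- vertex eventually stops serving; then `k` edges leaving `I` all leave some late `A` and avoid
  -- its deleted vertex, which is too many.
  by_cases h : ∃ x ∈ Q, ∃ᶠ A in l, G.IsOptCut k x A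
  · obtain ⟨x, hxQ, hx⟩ := h
    refine ⟨x, hxQ, ?_⟩
    obtain ⟨A, hA, hA'⟩ := (hx.and_eventually hne').exists
    obtain ⟨z, hzI, hzx⟩ := hA' x hxQ hA
    have hxI : x ∉ I := by
      obtain ⟨B, hB, hB'⟩ := (hx.and_eventually (hl x)).exists
      exact fun h => hB.1 (hB'.2 h)
    have hfin : (G.cutPairs {x} A).Finite :=
      Set.finite_of_encard_le_coe hA.2.2.2.1.le
    refine hA.of_le hxI hne ⟨z, hzI, hzx⟩ ?_
    rw [← hfin.cast_ncard_eq]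
    refine encard_le_of_frequently (eventually_mem_cutPairs hl {x}) (hx.mono fun B hB => ?_)
    rw [hfin.cast_ncard_eq]
    exact hB.2.2.2.2 A hA.1 hA.2.1 hA.2.2.1
  · exfalso
    simp only [not_exists, not_and, Filter.not_frequently] at h
    obtain ⟨a, ha⟩ := hne
    obtain ⟨z, hzI⟩ : ∃ z, z ∉ I := by
      obtain ⟨A, ⟨x, hxQ, hx⟩, hA⟩ := (hP.and hne').exists
      obtain ⟨z, hz, -⟩ := hA x hxQ hx
      exact ⟨z, hz⟩
    have hk := hG.le_encard_cutPairs ha hzI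
    obtain ⟨T, hT, hTk⟩ := Set.exists_subset_encard_eq hk
    have hTfin : T.Finite := Set.finite_of_encard_eq_coe hTk
    have hev : ∀ᶠ A in l, ∀ p ∈ T, p ∈ G.cutPairs ∅ A ∧ (p.2 ∈ Q → ¬ G.IsOptCut k p.2 A) := by
      refine (Filter.eventually_all_finite hTfin).2 fun p hp => ?_
      by_cases hpQ : p.2 ∈ Q
      · filter_upwards [eventually_mem_cutPairs hl ∅ p (hT hp), h _ hpQ] with A h1 h2
        exact ⟨h1, fun _ => h2⟩
      · filter_upwards [eventually_mem_cutPairs hl ∅ p (hT hp)] with A h1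
        exact ⟨h1, fun h => absurd h hpQ⟩
    obtain ⟨A, ⟨x, hxQ, hx⟩, hA⟩ := (hP.and hev).exists
    refine absurd (Set.encard_le_encard (s := T) (t := G.cutPairs {x} A) fun p hp => ?_)
      (not_le.2 (hTk ▸ hx.2.2.2.1))
    obtain ⟨⟨h1, h2, -, h4⟩, h5⟩ := hA p hp
    refine ⟨h1, h2, ?_, h4⟩
    rintro (h6 : p.2 = x)
    exact h5 (h6 ▸ hxQ) (h6 ▸ hx)

/-- If a set has few outgoing edges and all its degrees are large, then it has a vertex without
outgoing edges. -/
theorem exists_neighborSet_subset {V : Type*} {G : SimpleGraph V} {k : ℕ} {A X : Set V}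
    (hA : A.Nonempty) (hcut : X.encard + (G.cutPairs X A).encard ≤ k)
    (hdeg : ∀ a ∈ A, (k : ℕ∞) < (G.neighborSet a).encard) : ∃ a ∈ A, G.neighborSet a ⊆ A ∪ X := by
  classical
  by_contra! hcon
  have hout : ∀ a, ∃ b, a ∈ A → G.Adj a b ∧ b ∉ A ∧ b ∉ X := fun a => by
    by_cases ha : a ∈ A
    · obtain ⟨b, hb, hb'⟩ := Set.not_subset.1 (hcon a ha)
      exact ⟨b, fun _ => ⟨hb, fun h => hb' (Or.inl h), fun h => hb' (Or.inr h)⟩⟩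
    · exact ⟨a, fun h => absurd h ha⟩
  choose f hf using hout
  obtain ⟨a, ha⟩ := hA
  -- If each vertex of `A` sends an edge out of `A ∪ X`, the neighbours of `a` outside `X` inject
  -- into the cut: those in `A` through their own outgoing edges, the others through their edges to
  -- `a`.
  let g : V → V × V := fun b => if b ∈ A then (b, f b) else (a, b)
  have hinj : Set.InjOn g (G.neighborSet a \ X) := by
    rintro b ⟨hb, -⟩ c ⟨hc, -⟩ hbc
    have hba : b ≠ a := (G.ne_of_adj hb).symm
    have hca : c ≠ a := (G.ne_of_adj hc).symm
    simp only [g] at hbc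
    split_ifs at hbc with h1 h2 h2
    · exact congrArg Prod.fst hbc
    · exact absurd (congrArg Prod.fst hbc) hba
    · exact absurd (congrArg Prod.fst hbc).symm hca
    · exact congrArg Prod.snd hbc
  have hmaps : g '' (G.neighborSet a \ X) ⊆ G.cutPairs X A := by
    rintro _ ⟨b, ⟨hb, hbX⟩, rfl⟩
    simp only [g]
    split_ifs with h
    · obtain ⟨h1, h2, h3⟩ := hf b h
      exact ⟨h, h2, h3, h1⟩
    · exact ⟨ha, h, hbX, hb⟩
  have h1 : (G.neighborSet a).encard ≤ X.encard + (G.neighborSet a \ X).encard := by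
    refine (Set.encard_le_encard ?_).trans (Set.encard_union_le X (G.neighborSet a \ X))
    intro b hb
    by_cases h : b ∈ X
    · exact Or.inl h
    · exact Or.inr ⟨hb, h⟩
  have h2 : (G.neighborSet a \ X).encard ≤ (G.cutPairs X A).encard := by
    rw [← hinj.encard_image]
    exact Set.encard_le_encard hmaps
  exact absurd ((h1.trans (add_le_add le_rfl h2)).trans hcut) (not_le.2 (hdeg a ha))

/-- The positions of `v` and `x` decide which of them is deleted at which corner. In this case and
the next each corner keeps one deleted vertex; in the third, one corner gets both and the opposite
corner is an ordinary edge cut of `G`. -/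
theorem encard_cutPairs_uncross_mem_side {V : Type*} (G : SimpleGraph V) {A C : Set V} {v x : V}
    (hv : v ∉ A) (hx : x ∈ A) (hvC : v ∉ C) :
    (G.cutPairs {x} (A ∩ C)).encard + (G.cutPairs {v} ((A ∪ {v})ᶜ ∩ (C ∪ {x})ᶜ)).encard ≤
      (G.cutPairs {v} A).encard + (G.cutPairs {x} C).encard := by
  have hne : v ≠ x := by
    rintro rfl
    exact hv hx
  have h := G.encard_cutPairs_uncross (X := {v}) (A := A) (Y := {x}) (C := C)
  rw [show {v} ∩ C ∪ {v} ∩ {x} ∪ {x} ∩ A = ({x} : Set V) by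
      ext y
      simp only [Set.mem_union, Set.mem_inter_iff, Set.mem_singleton_iff]
      grind,
    show {v} ∩ (C ∪ {x})ᶜ ∪ {v} ∩ {x} ∪ {x} ∩ (A ∪ {v})ᶜ = ({v} : Set V) by
      ext y
      simp only [Set.mem_union, Set.mem_inter_iff, Set.mem_singleton_iff, Set.mem_compl_iff]
      grind] at h
  exact h

theorem encard_cutPairs_uncross_mem_other {V : Type*} (G : SimpleGraph V) {A C : Set V} {v x : V}
    (hx : x ∉ A) (hvC : v ∈ C) :
    (G.cutPairs {v} (A ∩ C)).encard + (G.cutPairs {x} ((A ∪ {v})ᶜ ∩ (C ∪ {x})ᶜ)).encard ≤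
      (G.cutPairs {v} A).encard + (G.cutPairs {x} C).encard := by
  have h := G.encard_cutPairs_uncross (X := {v}) (A := A) (Y := {x}) (C := C)
  rw [show {v} ∩ C ∪ {v} ∩ {x} ∪ {x} ∩ A = ({v} : Set V) by
      ext y
      simp only [Set.mem_union, Set.mem_inter_iff, Set.mem_singleton_iff]
      grind,
    show {v} ∩ (C ∪ {x})ᶜ ∪ {v} ∩ {x} ∪ {x} ∩ (A ∪ {v})ᶜ = ({x} : Set V) by
      ext y
      simp only [Set.mem_union, Set.mem_inter_iff, Set.mem_singleton_iff, Set.mem_compl_iff]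
      grind] at h
  exact h

theorem encard_cutPairs_uncross_mem_both {V : Type*} (G : SimpleGraph V) {A C : Set V} {v x : V}
    (hv : v ∉ A) (hx : x ∈ A) (hvC : v ∈ C) :
    (G.cutPairs {v, x} (A ∩ C)).encard + (G.cutPairs ∅ ((A ∪ {v})ᶜ ∩ (C ∪ {x})ᶜ)).encard ≤
      (G.cutPairs {v} A).encard + (G.cutPairs {x} C).encard := by
  have hne : v ≠ x := by
    rintro rfl
    exact hv hx
  have h := G.encard_cutPairs_uncross (X := {v}) (A := A) (Y := {x}) (C := C)
  rw [show {v} ∩ C ∪ {v} ∩ {x} ∪ {x} ∩ A = ({v, x} : Set V) by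
      ext y
      simp only [Set.mem_union, Set.mem_inter_iff, Set.mem_singleton_iff, Set.mem_insert_iff]
      grind,
    show {v} ∩ (C ∪ {x})ᶜ ∪ {v} ∩ {x} ∪ {x} ∩ (A ∪ {v})ᶜ = (∅ : Set V) by
      ext y
      simp only [Set.mem_union, Set.mem_inter_iff, Set.mem_singleton_iff, Set.mem_compl_iff,
        Set.mem_empty_iff_false]
      grind] at h
  exact h

/-- As `m` and `n` are at most `k - 1`, `d` is at most `2 * (k - 1) - k`. The 2 pays for the two
deleted vertices of a corner. -/
theorem ENat.two_add_le_of_add_le {d b m n : ℕ∞} {k : ℕ} (h : d + b ≤ m + n) (hb : k ≤ b)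
    (hm : m < k) (hn : n < k) : 2 + d ≤ k := by
  have h' : d + k ≤ m + n := (add_le_add le_rfl hb).trans h
  obtain ⟨m, rfl⟩ := ENat.ne_top_iff_exists.1 hm.ne_top
  obtain ⟨n, rfl⟩ := ENat.ne_top_iff_exists.1 hn.ne_top
  have hd : d ≠ ⊤ := by
    rintro rfl
    rw [top_add, top_le_iff, ← Nat.cast_add] at h'
    exact ENat.natCast_ne_top _ h'
  obtain ⟨d, rfl⟩ := ENat.ne_top_iff_exists.1 hd
  norm_cast at *
  omega

/-- Otherwise the same set would have fewer than `k` outgoing edges in `G` itself. -/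
theorem IsOptCut.exists_adj {V : Type*} {G : SimpleGraph V} {k : ℕ} (hG : G.IsEdgeConnected k)
    {x : V} {C : Set V} (hC : G.IsOptCut k x C) : ∃ y ∈ C, G.Adj y x := by
  by_contra! hcon
  obtain ⟨c, hc⟩ := hC.2.1
  refine absurd ((hG.le_encard_cutPairs hc hC.1).trans (Set.encard_le_encard ?_))
    (not_le.2 hC.2.2.2.1)
  rintro ⟨a, b⟩ ⟨h1, h2, -, h4⟩
  refine ⟨h1, h2, ?_, h4⟩
  rintro rfl
  exact hcon a h1 h4

theorem exists_isOptCut_notMem {V : Type*} {G : SimpleGraph V} {k : ℕ} {x : V} (v : V)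
    (h : ∃ C, G.IsOptCut k x C) : ∃ C, v ∉ C ∧ G.IsOptCut k x C := by
  obtain ⟨C, hC⟩ := h
  by_cases hv : v ∈ C
  · exact ⟨(C ∪ {x})ᶜ, fun h => h (Or.inl hv), hC.compl⟩
  · exact ⟨C, hv, hC⟩

/-- Otherwise the corner opposite to `A ∩ C` is a competing cut at `v`, and uncrossing makes `A ∩ C`
optimal at `x`. It is nonempty because `x` has a neighbour in `C`, which lies in `A` by the choice
of `x`. -/
theorem IsOptCut.compl_subset_of_minimal {V : Type*} {G : SimpleGraph V} {k : ℕ}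
    (hG : G.IsEdgeConnected k) {v : V} {A : Set V} (hA : G.IsOptCut k v A)
    (hmin : ∀ x ∈ A, ∀ B ⊆ A, ¬ G.IsOptCut k x B) {x : V} (hx : x ∈ A)
    (hxN : G.neighborSet x ⊆ A ∪ {v}) {C : Set V} (hC : G.IsOptCut k x C) (hvC : v ∉ C) :
    (C ∪ {x})ᶜ ⊆ A ∪ {v} := by
  intro z hz
  by_contra hzA
  have hvx : v ≠ x := by
    rintro rfl
    exact hA.1 hx
  obtain ⟨y, hyC, hyx⟩ := hC.exists_adj hG
  have hyA : y ∈ A := (hxN hyx.symm).resolve_right (by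
    rintro rfl
    exact hvC hyC)
  have h1 := G.encard_cutPairs_uncross_mem_side hA.1 hx hvC
  have h2 := hA.2.2.2.2 ((A ∪ {v})ᶜ ∩ (C ∪ {x})ᶜ) (fun h => h.1 (Or.inr rfl)) ⟨z, hzA, hz⟩
    ⟨x, fun h => h.2 (Or.inr rfl), hvx.symm⟩
  rw [add_comm (G.cutPairs {v} A).encard] at h1
  exact hmin x hx (A ∩ C) Set.inter_subset_left (hC.of_le (fun h => hC.1 h.2) ⟨y, hyA, hyC⟩
    ⟨v, fun h => hA.1 h.1, hvx⟩
    (ENat.le_of_add_le_add_of_le h1 h2 hA.2.2.2.1.ne_top))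

/-- If every vertex has an optimal cut, and `A` contains no smaller side of an optimal cut at one
of its vertices, then `A` contains a vertex of small degree unless its cut vertex is one. -/
theorem IsOptCut.encard_neighborSet_le_of_minimal {V : Type*} {G : SimpleGraph V} {k : ℕ}
    (hG : G.IsEdgeConnected k) (hopt : ∀ x, ∃ C, G.IsOptCut k x C) {v : V} {A : Set V}
    (hA : G.IsOptCut k v A) (hmin : ∀ x ∈ A, ∀ B ⊆ A, ¬ G.IsOptCut k x B)
    (hdeg : ∀ a ∈ A, (k : ℕ∞) < (G.neighborSet a).encard) : (G.neighborSet v).encard ≤ k := by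
  -- Vertices of `A` to which `compl_subset_of_minimal` applies. Among optimal cuts at vertices of
  -- `Q`, a side `C` avoiding `v` is taken maximal; its other side `D = (C ∪ {x})ᶜ` contains `v` and
  -- lies in `A ∪ {v}`.
  let Q : Set V := {x | x ∈ A ∧ G.neighborSet x ⊆ A ∪ {v}}
  have hvQ : ∀ x ∈ Q, v ≠ x := by
    rintro x hx rfl
    exact hA.1 hx.1
  obtain ⟨z, hzA, hzv⟩ := hA.2.2.1
  let S : Set (Set V) := {C | v ∉ C ∧ ∃ x ∈ Q, G.IsOptCut k x C}
  obtain ⟨C₀, hC₀⟩ : S.Nonempty := by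
    obtain ⟨x, hx, hxN⟩ := exists_neighborSet_subset (X := {v}) hA.2.1
      (by rw [Set.encard_singleton, add_comm]; exact Order.add_one_le_of_lt hA.2.2.2.1) hdeg
    obtain ⟨C, hvC, hC⟩ := exists_isOptCut_notMem v (hopt x)
    exact ⟨C, hvC, x, ⟨hx, hxN⟩, hC⟩
  obtain ⟨C, -, hCmax⟩ := zorn_subset_nonempty S (fun 𝒞 h𝒞 hch hne => by
    obtain ⟨l, hl, hmem, hlim⟩ := exists_filter_sUnion hch hne
    have hv : v ∉ ⋃₀ 𝒞 := fun ⟨B, hB, hvB⟩ => (h𝒞 hB).1 hvB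
    obtain ⟨B, hB⟩ := hne
    obtain ⟨b, hb⟩ : B.Nonempty := by
      obtain ⟨x, -, hx⟩ := (h𝒞 hB).2
      exact hx.2.1
    exact ⟨⋃₀ 𝒞, ⟨hv, IsOptCut.limit hG hlim (hmem.mono fun B hB => (h𝒞 hB).2) ⟨b, B, hB, hb⟩
      (Filter.Eventually.of_forall fun _ x hx _ => ⟨v, hv, hvQ x hx⟩)⟩, fun s hs => Set.subset_sUnion_of_mem hs⟩) C₀ hC₀
  obtain ⟨hvC, x, hxQ, hC⟩ := hCmax.1
  have hmax : ∀ B, v ∉ B → (∃ y ∈ Q, G.IsOptCut k y B) → C ⊆ B → B ⊆ C := fun B h1 h2 h3 =>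
    hCmax.2 ⟨h1, h2⟩ h3
  have hvx := hvQ x hxQ
  have hD := hA.compl_subset_of_minimal hG hmin hxQ.1 hxQ.2 hC hvC
  have hvD : v ∈ (C ∪ {x})ᶜ := fun h => h.elim hvC hvx
  have hzx : z ≠ x := by
    rintro rfl
    exact hzA hxQ.1
  have hzC : z ∈ C := by
    by_contra h
    exact (hD fun h' => h'.elim h hzx).elim hzA hzv
  by_cases hDv : (C ∪ {x})ᶜ = {v}
  · have h1 := G.encard_neighborSet_le {x} v
    rw [← hDv, Set.encard_singleton, add_comm] at h1
    exact h1.trans (Order.add_one_le_of_lt hC.compl.2.2.2.1)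
  exfalso
  -- If `D` is more than `{v}`, the corner `A ∩ D` has at most `k - 2` edges besides those to `v`
  -- and `x`. Counting then yields `y` in it whose neighbours all lie in `(A ∩ D) ∪ {v, x}`; so `y ∈
  -- Q`, and `y` has no neighbour in `C`.
  have hAD : (A ∩ (C ∪ {x})ᶜ).Nonempty := by
    by_contra h
    refine hDv (Set.eq_singleton_iff_unique_mem.2 ⟨hvD, fun y hy => ?_⟩)
    exact (hD hy).resolve_left fun h' => h ⟨y, h', hy⟩
  have hcut := G.encard_cutPairs_uncross_mem_both hA.1 hxQ.1 hvD
  obtain ⟨a, ha⟩ := hA.2.1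
  have hk : k ≤ (G.cutPairs ∅ ((A ∪ {v})ᶜ ∩ ((C ∪ {x})ᶜ ∪ {x})ᶜ)).encard :=
    hG.le_encard_cutPairs (a := z) (b := a)
      ⟨fun h => h.elim hzA hzv, fun h => h.elim (fun h' => h' (Or.inl hzC)) hzx⟩
      fun h => h.1 (Or.inl ha)
  obtain ⟨y, ⟨hyA, hyD⟩, hyN⟩ := exists_neighborSet_subset (X := {v, x}) hAD
    (by rw [Set.encard_pair hvx]
        exact ENat.two_add_le_of_add_le hcut hk hA.2.2.2.1 hC.compl.2.2.2.1)
    fun a ha => hdeg a ha.1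
  have hyC : y ∉ C := fun h => hyD (Or.inl h)
  have hyx : y ≠ x := fun h => hyD (Or.inr h)
  have hyQ : y ∈ Q := by
    refine ⟨hyA, fun w hw => ?_⟩
    rcases hyN hw with h | h | h
    · exact Or.inl h.1
    · exact Or.inr h
    · exact Or.inl (h ▸ hxQ.1)
  have hyadj : ∀ w ∈ C, ¬ G.Adj w y := by
    intro w hw hwy
    rcases hyN hwy.symm with h | h | h
    · exact h.2 (Or.inl hw)
    · exact hvC (h ▸ hw)
    · exact hC.1 (h ▸ hw)
  have hvy := hvQ y hyQ
  obtain ⟨C', hvC', hC'⟩ := exists_isOptCut_notMem v (hopt y)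
  have hD' := hA.compl_subset_of_minimal hG hmin hyA hyQ.2 hC' hvC'
  have hnotsub : ¬ C' ⊆ C := fun h => by
    obtain ⟨w, hw, hwy⟩ := hC'.exists_adj hG
    exact hyadj w (h hw) hwy
  -- If `x ∈ C'`, uncrossing makes `D ∩ D'` optimal at `y`, where `D' = (C' ∪ {y})ᶜ`. Its other side
  -- contains `C` and `x`, against the maximality of `C`.
  by_cases hxC' : x ∈ C'
  · have h1 := G.encard_cutPairs_uncross_mem_other (A := C) hyC hxC'
    have hzC' : z ∈ C' := by
      by_contra h
      refine (hD' fun h' => h'.elim h ?_).elim hzA hzv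
      rintro rfl
      exact hzA hyA
    have h2 := hC.2.2.2.2 (C ∩ C') (fun h => hC.1 h.1) ⟨z, hzC, hzC'⟩ ⟨v, fun h => hvC h.1, hvx⟩
    rw [add_comm, add_comm (G.cutPairs {x} C).encard] at h1
    have hE := hC'.of_le (B := (C ∪ {x})ᶜ ∩ (C' ∪ {y})ᶜ) (fun h => h.2 (Or.inr rfl))
      ⟨v, hvD, fun h => h.elim hvC' hvy⟩ ⟨x, fun h => h.1 (Or.inr rfl), hyx.symm⟩
      (ENat.le_of_add_le_add_of_le h1 h2 hC.2.2.2.1.ne_top)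
    have h3 := hmax ((C ∪ {x})ᶜ ∩ (C' ∪ {y})ᶜ ∪ {y})ᶜ (fun h => h (Or.inl ⟨hvD, fun h => h.elim hvC' hvy⟩)) ⟨y, hyQ, hE.compl⟩
      (fun w hw h => h.elim (fun h' => h'.1 (Or.inl hw)) (by
        rintro rfl
        exact hyC hw))
    exact hC.1 (h3 fun h => h.elim (fun h' => h'.1 (Or.inr rfl)) fun h => hyx.symm h)
  -- Here `C ∩ D'` lies in `A`. If nonempty, it is optimal at `x`, against the minimality of `A`; if
  -- empty, then `C ⊆ C'`, and maximality gives `C' ⊆ C`, which is false.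
  · have hxD' : x ∈ (C' ∪ {y})ᶜ := fun h => h.elim hxC' fun h => hyx.symm h
    have h1 := G.encard_cutPairs_uncross_mem_other (A := C) hyC hxD'
    obtain ⟨w, hwC', hwC⟩ := Set.not_subset.1 hnotsub
    have h2 := hC'.compl.2.2.2.2 ((C ∪ {x})ᶜ ∩ ((C' ∪ {y})ᶜ ∪ {y})ᶜ) (fun h => h.2 (Or.inr rfl))
      ⟨w, fun h => h.elim hwC (by
        rintro rfl
        exact hxC' hwC'), fun h => h.elim (fun h' => h' (Or.inl hwC')) (by
        rintro rfl
        exact hC'.1 hwC')⟩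
      ⟨v, fun h => h.2 (Or.inl fun h => h.elim hvC' hvy), hvy⟩
    have h3 := ENat.le_of_add_le_add_of_le h1 h2 hC'.compl.2.2.2.1.ne_top
    by_cases hne : (C ∩ (C' ∪ {y})ᶜ).Nonempty
    · refine hmin x hxQ.1 _ ?_ (hC.of_le (fun h => hC.1 h.1) hne ⟨v, fun h => hvC h.1, hvx⟩ h3)
      rintro u ⟨huC, huD⟩
      refine (hD' huD).resolve_right ?_
      rintro rfl
      exact hvC huC
    · refine hnotsub (hmax C' hvC' ⟨y, hyQ, hC'⟩ fun u hu => ?_)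
      by_contra huC'
      refine hne ⟨u, hu, fun h => h.elim huC' ?_⟩
      rintro rfl
      exact hyC hu

theorem lt_encard_neighborSet {V : Type*} {G : SimpleGraph V} {v : V} {k : ℕ}
    (h : v ∉ G.smallVertices k) : (k : ℕ∞) < (G.neighborSet v).encard := by
  by_contra hlt
  exact h (mem_smallVertices_of_encard_le (not_lt.1 hlt))

/-- The set `Z` confines both the sides and their deleted vertices, since the small vertex found may
be a deleted one. With `Z = {w}ᶜ` the result differs from a small vertex `w` already known. -/
theorem IsOptCut.exists_small {V : Type*} {G : SimpleGraph V} {k : ℕ}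
    (hG : G.IsEdgeConnected k) (hopt : ∀ x, ∃ C, G.IsOptCut k x C) {v₀ : V} {A₀ Z : Set V}
    (hA₀ : G.IsOptCut k v₀ A₀) (hv₀ : v₀ ∈ Z) (hA₀Z : A₀ ⊆ Z) :
    (∃ u ∈ Z, u ∈ G.smallVertices k) ∨ ∃ ω ∈ G.endsSmallVertexDegree k, LivesIn ω A₀ := by
  obtain ⟨K, hKA, hK, hKopt⟩ := hA₀.component
  let P : Set V → Prop := fun A => (G.induce A).Connected ∧ A ⊆ Z ∧ ∃ v ∈ Z, G.IsOptCut k v A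
  have hPK : P K := ⟨hK, hKA.trans hA₀Z, v₀, hv₀, hKopt⟩
  have hN : ∀ A, P A → (G.outerBoundary A).encard ≤ k := by
    rintro A ⟨-, -, v, -, hv⟩
    refine (encard_outerBoundary_le {v} A).trans ?_
    rw [Set.encard_singleton, add_comm]
    exact Order.add_one_le_of_lt hv.2.2.2.1
  have hlim : ∀ (l : Filter (Set V)) (I : Set V), l.NeBot → (∀ᶠ A in l, P A ∧ I ⊆ A) →
      (∀ y, ∀ᶠ A in l, (y ∈ A ↔ y ∈ I)) → I.Nonempty → ∃ B ⊆ I, P B := by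
    intro l I hl hP hlI hne
    obtain ⟨x, hxZ, hx⟩ := IsOptCut.limit hG hlI (hP.mono fun A hA => hA.1.2.2) hne
      (hP.mono fun A hA x _ hx => by
        obtain ⟨z, hz, hzx⟩ := hx.2.2.1
        exact ⟨z, fun h => hz (hA.2 h), hzx⟩)
    obtain ⟨B, hBI, hB, hBopt⟩ := hx.component
    obtain ⟨A, hA, hIA⟩ := hP.exists
    exact ⟨B, hBI, hB, hBI.trans (hIA.trans hA.2.1), x, hxZ, hBopt⟩
  rcases exists_minimal_or_end (fun A hA => hA.1) hN hlim hPK with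
    ⟨A, hAK, ⟨hA, hAZ, v, hvZ, hv⟩, hmin⟩ | ⟨ω, hω, hωK⟩
  · left
    by_cases hs : ∃ a ∈ A, a ∈ G.smallVertices k
    · obtain ⟨a, ha, ha'⟩ := hs
      exact ⟨a, hAZ ha, ha'⟩
    · refine ⟨v, hvZ, mem_smallVertices_of_encard_le
        (hv.encard_neighborSet_le_of_minimal hG hopt ?_ ?_)⟩
      · intro x hx B hBA hB
        obtain ⟨L, hLB, hL, hLopt⟩ := hB.component
        have := hmin L (hLB.trans hBA) ⟨hL, (hLB.trans hBA).trans hAZ, x, hAZ hx, hLopt⟩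
        exact hLopt.1 (this ▸ hx)
      · exact fun a ha => lt_encard_neighborSet fun h => hs ⟨a, ha, h⟩
  · exact Or.inr ⟨ω, hω, hωK.mono hKA⟩

theorem IsVertexMinKEdgeConnected.exists_isOptCut {V : Type*} {G : SimpleGraph V} {k : ℕ}
    (hG : G.IsVertexMinKEdgeConnected k) {v : V} (hv : ({v}ᶜ : Set V).Nontrivial) :
    ∃ C, G.IsOptCut k v C := by
  have hnt : Nontrivial ({v}ᶜ : Set V) := hv.coe_sort
  have hnot : ¬ (G.induce {v}ᶜ).IsEdgeConnected k := fun h => hG.2 v ⟨hnt, h⟩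
  obtain ⟨A, ⟨a, ha⟩, ⟨b, hb⟩, hA⟩ := exists_cut_of_not_isEdgeConnected hnot
  refine SimpleGraph.exists_isOptCut ⟨Subtype.val '' A, ?_, ⟨a, a, ha, rfl⟩, ⟨b, ?_, b.2⟩, ?_⟩
  · rintro ⟨x, -, hx⟩
    exact x.2 hx
  · rintro ⟨x, hx, hxb⟩
    exact hb (Subtype.ext hxb ▸ hx)
  · refine lt_of_le_of_lt ((Set.encard_le_encard ?_).trans
      (Set.encard_image_le (Prod.map Subtype.val Subtype.val) _)) hA
    rintro ⟨x, y⟩ ⟨⟨x', hx', rfl⟩, hy, hyv, hxy⟩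
    exact ⟨(x', ⟨y, hyv⟩), ⟨hx', fun h => hy ⟨_, h, rfl⟩, id, hxy⟩, rfl⟩

theorem IsVertexMinKEdgeConnected.two_le {V : Type*} {G : SimpleGraph V} {k : ℕ} (hk : 1 ≤ k)
    (hG : G.IsVertexMinKEdgeConnected k) :
    2 ≤ #(G.vertexEndUnion (G.smallVertices k) (G.endsSmallVertexDegree k)) := by
  have := hG.1.1
  by_cases hsub : ∃ v : V, ({v}ᶜ : Set V).Subsingleton
  · obtain ⟨v, hv⟩ := hsub
    have hall : ∀ u, u ∈ G.smallVertices k := fun u => by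
      refine mem_smallVertices_of_encard_le (le_trans ?_ (Nat.cast_le.2 hk))
      rw [Nat.cast_one, Set.encard_le_one_iff]
      intro a b ha hb
      by_contra hab
      have hua := G.ne_of_adj ha
      have hub := G.ne_of_adj hb
      by_cases huv : u = v
      · exact hab (hv (huv ▸ hua.symm) (huv ▸ hub.symm))
      · by_cases hav : a = v
        · exact hub (hv huv (hav ▸ fun h => hab h.symm))
        · exact hua (hv huv hav)
    obtain ⟨a, b, hab⟩ := exists_pair_ne V
    exact two_le_mk_of_ne (a := Sum.inl a) (b := Sum.inl b) (Or.inl ⟨a, hall a, rfl⟩)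
      (Or.inl ⟨b, hall b, rfl⟩) fun h => hab (Sum.inl_injective h)
  -- If a small vertex `w` exists, a side avoiding it gives another small vertex or an end. If none
  -- exists, the two sides of one cut contain different ends.
  · have hopt : ∀ v, ∃ C, G.IsOptCut k v C := fun v =>
      hG.exists_isOptCut (Set.not_subsingleton_iff.1 fun h => hsub ⟨v, h⟩)
    by_cases hw : ∃ w, w ∈ G.smallVertices k
    · obtain ⟨w, hw⟩ := hw
      obtain ⟨x, hx⟩ := exists_ne w
      obtain ⟨C, hwC, hC⟩ := exists_isOptCut_notMem w (hopt x)
      rcases hC.exists_small hG.1.2 hopt (Z := {w}ᶜ) hx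
        (fun y hy h => hwC (h ▸ hy)) with ⟨u, huw, hu⟩ | ⟨ω, hω, -⟩
      · exact two_le_mk_of_ne (a := Sum.inl u) (b := Sum.inl w) (Or.inl ⟨u, hu, rfl⟩)
          (Or.inl ⟨w, hw, rfl⟩) fun h => huw (Sum.inl_injective h)
      · exact two_le_mk_of_ne (a := Sum.inl w) (b := Sum.inr ω) (Or.inl ⟨w, hw, rfl⟩)
          (Or.inr ⟨ω, hω, rfl⟩) Sum.inl_ne_inr
    · obtain ⟨v⟩ : Nonempty V := inferInstance
      obtain ⟨C, hC⟩ := hopt v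
      have key : ∀ B, G.IsOptCut k v B → ∃ ω ∈ G.endsSmallVertexDegree k, LivesIn ω B :=
        fun B hB => (hB.exists_small hG.1.2 hopt (Set.mem_univ v) (Set.subset_univ B)).resolve_left
          fun ⟨u, _, hu⟩ => hw ⟨u, hu⟩
      obtain ⟨ω, hω, hωC⟩ := key C hC
      obtain ⟨ω', hω', hωC'⟩ := key _ hC.compl
      refine two_le_mk_of_ne (a := Sum.inr ω) (b := Sum.inr ω') (Or.inr ⟨ω, hω, rfl⟩)
        (Or.inr ⟨ω', hω', rfl⟩) fun h => ?_
      exact hωC.ne hωC' (Set.disjoint_left.2 fun y hy h => h (Or.inl hy)) (Sum.inr_injective h)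

/-! ### Vertex-minimally `k`-connected graphs: fragments -/

theorem IsKConnected.le_encard_outerBoundary {V : Type*} {G : SimpleGraph V} {k : ℕ}
    (hG : G.IsKConnected k) {A : Set V} (hA : A.Nonempty) (hA' : (A ∪ G.outerBoundary A)ᶜ.Nonempty) :
    k ≤ (G.outerBoundary A).encard := by
  by_contra hlt
  obtain ⟨a, ha⟩ := hA
  obtain ⟨b, hb⟩ := hA'
  refine hb (Or.inl (subset_of_induce_connected (hG.2 _ (not_le.1 hlt)) (a := a) (fun h => h.1 ha)
    ha (fun x hx y hy hxy => ?_) fun h => hb (Or.inr h)))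
  by_contra hyA
  exact hy ⟨hyA, x, hx, hxy⟩

/-- A union of components of the graph minus a set of `k` vertices, but not of all components. -/
def IsFragment {V : Type*} (G : SimpleGraph V) (k : ℕ) (A : Set V) : Prop :=
  A.Nonempty ∧ (G.outerBoundary A).encard = k ∧ (A ∪ G.outerBoundary A)ᶜ.Nonempty

theorem IsKConnected.isFragment {V : Type*} {G : SimpleGraph V} {k : ℕ} (hG : G.IsKConnected k)
    {A : Set V} (hA : A.Nonempty) (hA' : (A ∪ G.outerBoundary A)ᶜ.Nonempty)
    (hle : (G.outerBoundary A).encard ≤ k) : G.IsFragment k A :=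
  ⟨hA, hle.antisymm (hG.le_encard_outerBoundary hA hA'), hA'⟩

theorem IsFragment.finite {V : Type*} {G : SimpleGraph V} {k : ℕ} {A : Set V}
    (hA : G.IsFragment k A) : (G.outerBoundary A).Finite :=
  Set.finite_of_encard_eq_coe hA.2.1

theorem IsFragment.ncard {V : Type*} {G : SimpleGraph V} {k : ℕ} {A : Set V}
    (hA : G.IsFragment k A) : (G.outerBoundary A).ncard = k := by
  rw [Set.ncard, hA.2.1, ENat.toNat_natCast]

theorem IsFragment.outerBoundary_compl {V : Type*} {G : SimpleGraph V} {k : ℕ}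
    (hG : G.IsKConnected k) {A : Set V} (hA : G.IsFragment k A) :
    G.outerBoundary (A ∪ G.outerBoundary A)ᶜ = G.outerBoundary A := by
  have hsub : G.outerBoundary (A ∪ G.outerBoundary A)ᶜ ⊆ G.outerBoundary A := by
    rintro y ⟨hy, x, hx, hxy⟩
    refine (not_not.1 hy).resolve_left fun hyA => hx (Or.inr ⟨fun h => hx (Or.inl h), y, hyA, ?_⟩)
    exact hxy.symm
  obtain ⟨a, ha⟩ := hA.1
  refine (hA.finite.subset hsub).eq_of_subset_of_encard_le hsub ?_
  rw [hA.2.1]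
  exact hG.le_encard_outerBoundary hA.2.2 ⟨a, fun h => h.elim (fun h' => h' (Or.inl ha))
    fun h' => (hsub h').1 ha⟩

theorem IsFragment.compl_compl {V : Type*} {G : SimpleGraph V} {k : ℕ}
    (hG : G.IsKConnected k) {A : Set V} (hA : G.IsFragment k A) :
    ((A ∪ G.outerBoundary A)ᶜ ∪ G.outerBoundary (A ∪ G.outerBoundary A)ᶜ)ᶜ = A := by
  rw [hA.outerBoundary_compl hG]
  ext y
  have : y ∈ A → y ∉ G.outerBoundary A := fun h h' => h'.1 h
  simp only [Set.mem_compl_iff, Set.mem_union]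
  tauto

theorem IsFragment.compl {V : Type*} {G : SimpleGraph V} {k : ℕ} (hG : G.IsKConnected k)
    {A : Set V} (hA : G.IsFragment k A) : G.IsFragment k (A ∪ G.outerBoundary A)ᶜ :=
  ⟨hA.2.2, by rw [hA.outerBoundary_compl hG, hA.2.1], by rw [hA.compl_compl hG]; exact hA.1⟩

theorem ncard_inter_add {α : Type*} {S C T : Set α} (hS : S.Finite) (hCT : Disjoint C T) :
    (S ∩ C).ncard + (S ∩ T).ncard + (S ∩ (C ∪ T)ᶜ).ncard = S.ncard := by
  rw [← Set.ncard_union_eq (Set.disjoint_of_subset Set.inter_subset_right Set.inter_subset_right hCT)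
    (hS.inter_of_left C) (hS.inter_of_left T), ← Set.inter_union_distrib_left,
    ← Set.sdiff_eq, Set.ncard_inter_add_ncard_sdiff_eq_ncard _ _ hS]

theorem disjoint_outerBoundary {V : Type*} (G : SimpleGraph V) (A : Set V) :
    Disjoint A (G.outerBoundary A) :=
  Set.disjoint_left.2 fun _ ha h => h.1 ha

/-- The corner of two fragments. -/
theorem IsFragment.corner {V : Type*} {G : SimpleGraph V} {k : ℕ} (hG : G.IsKConnected k)
    {A C : Set V} (hA : G.IsFragment k A) (hC : G.IsFragment k C) (hAC : (A ∩ C).Nonempty) :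
    k ≤ (G.outerBoundary A ∩ C).ncard + (G.outerBoundary A ∩ G.outerBoundary C).ncard +
        (G.outerBoundary C ∩ A).ncard ∧
      ((G.outerBoundary A ∩ C).ncard + (G.outerBoundary A ∩ G.outerBoundary C).ncard +
        (G.outerBoundary C ∩ A).ncard ≤ k → G.IsFragment k (A ∩ C)) := by
  have hsub : G.outerBoundary (A ∩ C) ⊆ (G.outerBoundary A ∩ C) ∪
      (G.outerBoundary A ∩ G.outerBoundary C) ∪ (G.outerBoundary C ∩ A) := by
    rintro y ⟨hy, x, hx, hxy⟩
    have h1 : y ∈ A ∨ y ∈ G.outerBoundary A := by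
      by_cases h : y ∈ A
      · exact Or.inl h
      · exact Or.inr ⟨h, x, hx.1, hxy⟩
    have h2 : y ∈ C ∨ y ∈ G.outerBoundary C := by
      by_cases h : y ∈ C
      · exact Or.inl h
      · exact Or.inr ⟨h, x, hx.2, hxy⟩
    have h3 : ¬ (y ∈ A ∧ y ∈ C) := hy
    simp only [Set.mem_union, Set.mem_inter_iff]
    tauto
  have hfin : (G.outerBoundary A ∩ C ∪ (G.outerBoundary A ∩ G.outerBoundary C) ∪
      (G.outerBoundary C ∩ A)).Finite :=
    ((hA.finite.inter_of_left _).union (hA.finite.inter_of_left _)).union (hC.finite.inter_of_left _)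
  have hle : (G.outerBoundary (A ∩ C)).encard ≤ (((G.outerBoundary A ∩ C).ncard +
      (G.outerBoundary A ∩ G.outerBoundary C).ncard + (G.outerBoundary C ∩ A).ncard : ℕ) : ℕ∞) := by
    refine (Set.encard_le_encard hsub).trans ?_
    rw [← hfin.cast_ncard_eq]
    exact Nat.cast_le.2 ((Set.ncard_union_le _ _).trans
      (Nat.add_le_add_right (Set.ncard_union_le _ _) _))
  have hrest : (A ∩ C ∪ G.outerBoundary (A ∩ C))ᶜ.Nonempty :=
    hA.2.2.mono (Set.compl_subset_compl.2 (outerBoundary_mono_union Set.inter_subset_left))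
  exact ⟨Nat.cast_le.1 ((hG.le_encard_outerBoundary hAC hrest).trans hle),
    fun h => hG.isFragment hAC hrest (hle.trans (Nat.cast_le.2 h))⟩

/-- `sc`, `st`, `sd` and `ta`, `st`, `tb` are the sizes of the parts of two crossing separators, and
`ac`, `ad`, `bc`, `bd` say that a corner is nonempty. The bounds of opposite corners add up to `2 *
k`, so they cannot both be nonempty when one of them lies in `A`. A side whose two corners are empty
lies in a separator and, unless it is small, takes more than half of it. `b` says that the
complement of `A` is not small. -/
theorem corner_arithmetic {k sc st sd ta tb : ℕ} {ac ad bc bd b : Prop}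
    (hS : sc + st + sd = k) (hT : ta + st + tb = k) (hac : ac → k < sc + st + ta)
    (had : ad → k < sd + st + ta) (hbc : bc → k ≤ sc + st + tb) (hbd : bd → k ≤ sd + st + tb)
    (hA : ¬ ac → ¬ ad → k < 2 * ta) (hC : ¬ ac → ¬ bc → k < 2 * sc)
    (hD : ¬ ad → ¬ bd → k < 2 * sd) (hB : ¬ bc → ¬ bd → b → k < 2 * tb) : ¬ bc ∧ ¬ bd ∧ ¬ b := by
  by_cases h1 : ac <;> by_cases h2 : ad <;> by_cases h3 : bc <;> by_cases h4 : bd <;>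
    by_cases h5 : b <;> simp only [h1, h2, h3, h4, h5, forall_true_left, not_true_eq_false,
      false_implies, not_false_eq_true, and_true, and_self, and_false] at * <;> omega

/-- In a minimal fragment, a separator through one of its vertices forces a small fragment. -/
theorem IsFragment.small_compl_of_minimal {V : Type*} {G : SimpleGraph V} {k : ℕ}
    (hG : G.IsKConnected k) {A C : Set V} (hA : G.IsFragment k A)
    (hmin : ∀ B ⊆ A, G.IsFragment k B → B = A) (hC : G.IsFragment k C) {x : V} (hxA : x ∈ A)
    (hxC : x ∈ G.outerBoundary C) (hA' : ¬ 2 * A.encard ≤ k) (hC' : ¬ 2 * C.encard ≤ k)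
    (hD' : ¬ 2 * ((C ∪ G.outerBoundary C)ᶜ).encard ≤ k) :
    (A ∪ G.outerBoundary A)ᶜ ⊆ G.outerBoundary C ∧
      2 * ((A ∪ G.outerBoundary A)ᶜ).encard ≤ k := by
  have hB := hA.compl hG
  have hD := hC.compl hG
  have hSk := ncard_inter_add hA.finite (G.disjoint_outerBoundary C)
  have hTk := ncard_inter_add hC.finite (G.disjoint_outerBoundary A)
  rw [hA.ncard] at hSk
  rw [hC.ncard, Set.inter_comm (G.outerBoundary C) (G.outerBoundary A)] at hTk
  have cAC := hA.corner hG hC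
  have cAD := hA.corner hG hD
  have cBC := hB.corner hG hC
  have cBD := hB.corner hG hD
  rw [hC.outerBoundary_compl hG] at cAD cBD
  rw [hA.outerBoundary_compl hG] at cBC cBD
  have hSfin := hA.finite
  have hTfin := hC.finite
  set S := G.outerBoundary A
  set T := G.outerBoundary C
  set B := (A ∪ S)ᶜ
  set D := (C ∪ T)ᶜ
  -- A corner inside `A` that misses `x` is smaller than `A`, hence no fragment; so its bound in
  -- `corner_arithmetic` is strict.
  have strict : ∀ E : Set V, x ∉ E → ¬ G.IsFragment k (A ∩ E) := fun E hE h =>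
    hE ((hmin _ Set.inter_subset_left h).symm ▸ hxA : x ∈ A ∩ E).2
  have sAC := strict C hxC.1
  have sAD := strict D fun h => h (Or.inr hxC)
  have hsmall : ∀ E F : Set V, F.Finite → E ⊆ F → ¬ 2 * E.encard ≤ k → k < 2 * F.ncard := by
    intro E F hF hEF hE
    by_contra hlt
    refine hE ((mul_le_mul_right (Set.encard_le_encard hEF) _).trans ?_)
    rw [← hF.cast_ncard_eq]
    exact_mod_cast not_lt.1 hlt
  have hfT : ∀ E : Set V, (T ∩ E).Finite := fun E => hTfin.inter_of_left E
  have hfS : ∀ E : Set V, (S ∩ E).Finite := fun E => hSfin.inter_of_left E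
  have coverT : ∀ E : Set V, ¬ (E ∩ C).Nonempty → ¬ (E ∩ D).Nonempty → E ⊆ T := by
    intro E h1 h2 y hy
    by_contra hyT
    by_cases hyC : y ∈ C
    · exact h1 ⟨y, hy, hyC⟩
    · exact h2 ⟨y, hy, fun h => h.elim hyC hyT⟩
  have coverS : ∀ E : Set V, ¬ (A ∩ E).Nonempty → ¬ (B ∩ E).Nonempty → E ⊆ S := by
    intro E h1 h2 y hy
    by_contra hyS
    by_cases hyA : y ∈ A
    · exact h1 ⟨y, hyA, hy⟩
    · exact h2 ⟨y, fun h => h.elim hyA hyS, hy⟩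
  have eA : ¬ (A ∩ C).Nonempty → ¬ (A ∩ D).Nonempty → k < 2 * (T ∩ A).ncard := fun h1 h2 =>
    hsmall A _ (hfT A) (fun y hy => ⟨coverT A h1 h2 hy, hy⟩) hA'
  have eC : ¬ (A ∩ C).Nonempty → ¬ (B ∩ C).Nonempty → k < 2 * (S ∩ C).ncard := fun h1 h2 =>
    hsmall C _ (hfS C) (fun y hy => ⟨coverS C h1 h2 hy, hy⟩) hC'
  have eD : ¬ (A ∩ D).Nonempty → ¬ (B ∩ D).Nonempty → k < 2 * (S ∩ D).ncard := fun h1 h2 =>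
    hsmall D _ (hfS D) (fun y hy => ⟨coverS D h1 h2 hy, hy⟩) hD'
  have eB : ¬ (B ∩ C).Nonempty → ¬ (B ∩ D).Nonempty → ¬ 2 * B.encard ≤ k →
      k < 2 * (T ∩ B).ncard := fun h1 h2 h3 =>
    hsmall B _ (hfT B) (fun y hy => ⟨coverT B h1 h2 hy, hy⟩) h3
  have h := corner_arithmetic hSk hTk
    (fun h => Nat.lt_of_not_le fun hle => sAC ((cAC h).2 hle))
    (fun h => Nat.lt_of_not_le fun hle => sAD ((cAD h).2 hle))
    (fun h => (cBC h).1) (fun h => (cBD h).1) eA eC eD eB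
  exact ⟨coverT B h.1 h.2.1, not_not.1 h.2.2⟩

theorem IsFragment.mem_smallVertices {V : Type*} {G : SimpleGraph V} {k : ℕ} {A : Set V}
    (hA : G.IsFragment k A) (hsmall : 2 * A.encard ≤ k) {a : V} (ha : a ∈ A) :
    a ∈ G.smallVertices (3 * k / 2 - 1) := by
  have hfin : A.Finite := by
    rw [← Set.encard_ne_top_iff]
    intro h
    rw [h, ENat.mul_top (by norm_num), top_le_iff] at hsmall
    exact ENat.natCast_ne_top k hsmall
  have hsub : G.neighborSet a ⊆ (A \ {a}) ∪ G.outerBoundary A := by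
    intro b hb
    by_cases hbA : b ∈ A
    · exact Or.inl ⟨hbA, (G.ne_of_adj hb).symm⟩
    · exact Or.inr ⟨hbA, a, ha, hb⟩
  have hfin' : ((A \ {a}) ∪ G.outerBoundary A).Finite := hfin.sdiff.union hA.finite
  refine ⟨hfin'.subset hsub, ?_⟩
  have h1 := (Set.ncard_le_ncard hsub hfin').trans (Set.ncard_union_le _ _)
  rw [hA.ncard] at h1
  have h2 := Set.ncard_sdiff_singleton_add_one ha hfin
  rw [← hfin.cast_ncard_eq] at hsmall
  have h3 : 2 * A.ncard ≤ k := by exact_mod_cast hsmall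
  have h4 : 2 * (G.neighborSet a).ncard + 2 ≤ 3 * k := by omega
  have h5 : (2 * (G.neighborSet a).ncard + 2 : ℚ) ≤ 3 * k := by exact_mod_cast h4
  linarith

/-- In a vertex-minimally `k`-connected graph that is not complete, every vertex lies in a
separator of size `k`. -/
theorem IsVertexMinKConnected.exists_isFragment {V : Type*} {G : SimpleGraph V} {k : ℕ}
    (hG : G.IsVertexMinKConnected k) {v : V} (hv : (k : Cardinal) < #({v}ᶜ : Set V)) :
    ∃ C, G.IsFragment k C ∧ v ∈ G.outerBoundary C := by
  have hnot := hG.2 v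
  simp only [IsKConnected, not_and, not_forall] at hnot
  obtain ⟨X, hX, hXc⟩ := hnot hv
  have hne : Nonempty (Xᶜ : Set ({v}ᶜ : Set V)) := by
    by_contra h
    rw [Set.nonempty_coe_sort, Set.not_nonempty_iff_eq_empty, Set.compl_empty_iff] at h
    have hfin : X.Finite := Set.finite_of_encard_le_coe hX.le
    subst h
    have h2 := Set.cast_ncard hfin
    rw [mk_univ] at h2
    rw [← h2] at hv
    rw [← hfin.cast_ncard_eq] at hX
    exact absurd (Nat.cast_lt.1 hv) (not_lt.2 (Nat.cast_lt.1 hX).le)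
  have hpre : ¬ ((G.induce {v}ᶜ).induce Xᶜ).Preconnected := fun h => hXc ⟨h⟩
  simp only [Preconnected, not_forall] at hpre
  obtain ⟨a, b, hab⟩ := hpre
  -- With `v`, the fewer than `k` vertices separating `G - v` become at most `k` vertices separating
  -- `G`. The outer boundary of `C` lies in `T` and has at least `k` vertices, so it is all of `T`
  -- and contains `v`.
  let T : Set V := insert v (Subtype.val '' X)
  have hT : T.encard ≤ k := (Set.encard_insert_le _ _).trans
    ((add_le_add (Set.encard_image_le _ _) le_rfl).trans (Order.add_one_le_of_lt hX))
  let C : Set V := {z | ∃ (h : z ∈ ({v}ᶜ : Set V)) (h' : (⟨z, h⟩ : ({v}ᶜ : Set V)) ∈ Xᶜ),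
    ((G.induce {v}ᶜ).induce Xᶜ).Reachable a ⟨⟨z, h⟩, h'⟩}
  have hCT : G.outerBoundary C ⊆ T := by
    rintro y ⟨hy, x, ⟨hx, hx', hr⟩, hxy⟩
    by_contra hyT
    have hyv : y ∈ ({v}ᶜ : Set V) := fun h => hyT (Or.inl h)
    have hyX : (⟨y, hyv⟩ : ({v}ᶜ : Set V)) ∈ Xᶜ := fun h => hyT (Or.inr ⟨_, h, rfl⟩)
    refine hy ⟨hyv, hyX, hr.trans (Adj.reachable ?_)⟩
    exact hxy
  have hbC : (b : V) ∉ C := fun ⟨_, _, h⟩ => hab h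
  have hbT : ((b : ({v}ᶜ : Set V)) : V) ∉ T := by
    rintro (h | ⟨y, hy, hyb⟩)
    · exact b.1.2 h
    · exact b.2 (Subtype.ext hyb ▸ hy)
  have hC : G.IsFragment k C := hG.1.isFragment ⟨a, a.1.2, a.2, Reachable.refl _⟩
    ⟨b, fun h => h.elim hbC fun h' => hbT (hCT h')⟩ ((Set.encard_le_encard hCT).trans hT)
  refine ⟨C, hC, ?_⟩
  rw [hC.finite.eq_of_subset_of_encard_le hCT (hC.2.1 ▸ hT)]
  exact Or.inl rfl

theorem IsKConnected.exists_minimal_fragment_or_end {V : Type*} {G : SimpleGraph V} {k : ℕ}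
    (hG : G.IsKConnected k) {A₀ : Set V} (hA₀ : G.IsFragment k A₀) :
    (∃ A ⊆ A₀, G.IsFragment k A ∧ ∀ B ⊆ A, G.IsFragment k B → B = A) ∨
      ∃ ω : G.Ends, ω ∈ G.endsSmallVertexDegree k ∧ LivesIn ω A₀ := by
  let P : Set V → Prop := fun A => (G.induce A).Connected ∧ G.IsFragment k A
  have hcomp : ∀ B : Set V, B.Nonempty → (G.outerBoundary B).encard ≤ k →
      (B ∪ G.outerBoundary B)ᶜ.Nonempty → ∃ K ⊆ B, P K := by
    rintro B ⟨b, hb⟩ hB hB'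
    obtain ⟨K, hKB, hbK, hK, hcl⟩ := G.exists_component hb
    exact ⟨K, hKB, hK, hG.isFragment ⟨b, hbK⟩
      (hB'.mono (Set.compl_subset_compl.2 (outerBoundary_mono_union hKB)))
      ((Set.encard_le_encard (outerBoundary_component_subset hKB hcl)).trans hB)⟩
  obtain ⟨K, hKA, hK⟩ := hcomp A₀ hA₀.1 hA₀.2.1.le hA₀.2.2
  have hlim : ∀ (l : Filter (Set V)) (I : Set V), l.NeBot → (∀ᶠ A in l, P A ∧ I ⊆ A) →
      (∀ y, ∀ᶠ A in l, (y ∈ A ↔ y ∈ I)) → I.Nonempty → ∃ B ⊆ I, P B := by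
    intro l I hl hP hlI hne
    obtain ⟨A, hA, hIA⟩ := hP.exists
    exact hcomp I hne (encard_le_of_frequently (eventually_mem_outerBoundary hlI)
      (hP.mono fun A hA => hA.1.2.2.1.le).frequently)
      (hA.2.2.2.mono (Set.compl_subset_compl.2 (outerBoundary_mono_union hIA)))
  rcases exists_minimal_or_end (k := k) (fun A hA => hA.1) (fun A hA => hA.2.2.1.le) hlim hK with
    ⟨A, hAK, hA, hmin⟩ | ⟨ω, hω, hωK⟩
  -- Minimality among connected fragments is minimality among all, since every fragment contains a
  -- connected one.
  · refine Or.inl ⟨A, hAK.trans hKA, hA.2, fun B hBA hB => ?_⟩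
    obtain ⟨L, hLB, hL⟩ := hcomp B hB.1 hB.2.1.le hB.2.2
    exact Set.Subset.antisymm hBA (hmin L (hLB.trans hBA) hL ▸ hLB)
  · exact Or.inr ⟨ω, hω, hωK.mono hKA⟩

theorem IsVertexMinKConnected.two_le {V : Type*} {G : SimpleGraph V} {k : ℕ} (hk : 1 ≤ k)
    (hG : G.IsVertexMinKConnected k) (hV : k = 1 → #V ≠ 2) :
    2 ≤ #(G.vertexEndUnion (G.smallVertices (3 * k / 2 - 1)) (G.endsSmallVertexDegree k)) := by
  by_contra hcon
  have huniq : ∀ z ∈ G.vertexEndUnion (G.smallVertices (3 * k / 2 - 1)) (G.endsSmallVertexDegree k),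
      ∀ w ∈ G.vertexEndUnion (G.smallVertices (3 * k / 2 - 1)) (G.endsSmallVertexDegree k),
      z = w := fun z hz w hw => by
    by_contra h
    exact hcon (two_le_mk_of_ne hz hw h)
  have hvert : ∀ a b, a ∈ G.smallVertices (3 * k / 2 - 1) → b ∈ G.smallVertices (3 * k / 2 - 1) →
      a = b := fun a b ha hb =>
    Sum.inl_injective (huniq (Sum.inl a) (Or.inl ⟨a, ha, rfl⟩) (Sum.inl b) (Or.inl ⟨b, hb, rfl⟩))
  -- Otherwise the graph has `k + 1` vertices, and all degrees are at most `k`, which is at most `3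
  -- * k / 2 - 1` because the case of `K^2` leaves only `k ≥ 2`.
  have hbig : ∀ v : V, (k : Cardinal) < #({v}ᶜ : Set V) := by
    intro v
    by_contra hle
    rw [not_lt] at hle
    have hVle : #V ≤ (k + 1 : ℕ) := by
      rw [← mk_sum_compl ({v} : Set V), mk_singleton, Nat.cast_add, Nat.cast_one, add_comm]
      exact add_le_add hle le_rfl
    have hlt := hG.1.1
    have : Finite V := lt_aleph0_iff_finite.1 (hVle.trans_lt (natCast_lt_aleph0))
    have := Fintype.ofFinite V
    classical
    rw [mk_fintype] at hVle hlt hV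
    have h1 : k < Fintype.card V := by exact_mod_cast hlt
    have h2 : Fintype.card V ≤ k + 1 := by exact_mod_cast hVle
    have hk1 : k ≠ 1 := by
      intro h
      refine hV h ?_
      rw [show Fintype.card V = 2 by omega, Nat.cast_ofNat]
    have hall : ∀ u, u ∈ G.smallVertices (3 * k / 2 - 1) := by
      intro u
      refine ⟨Set.toFinite _, ?_⟩
      have h3 : (G.neighborSet u).ncard < Fintype.card V := by
        rw [Set.ncard_eq_toFinset_card', ← neighborFinset_def]
        exact G.degree_lt_card_verts u
      have h4 : 2 * (G.neighborSet u).ncard + 2 ≤ 3 * k := by omega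
      have h5 : (2 * (G.neighborSet u).ncard + 2 : ℚ) ≤ 3 * k := by exact_mod_cast h4
      linarith
    obtain ⟨a, b, hab⟩ := Fintype.exists_pair_of_one_lt_card (α := V) (by omega)
    exact hab (hvert a b (hall a) (hall b))
  have hfrag : ∀ v, ∃ C, G.IsFragment k C ∧ v ∈ G.outerBoundary C := fun v =>
    hG.exists_isFragment (hbig v)
  by_cases hsm : ∃ A, G.IsFragment k A ∧ 2 * A.encard ≤ k
  · obtain ⟨C₀, hC₀, hC₀s⟩ := hsm
    obtain ⟨c, hc⟩ := hC₀.1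
    have hcs := hC₀.mem_smallVertices hC₀s hc
    -- All vertices of a fragment with at most `k / 2` vertices are small vertices, so `{c}` is the
    -- only such fragment.
    have honly : ∀ A, G.IsFragment k A → 2 * A.encard ≤ k → A = {c} := fun A hA hAs => by
      obtain ⟨a, ha⟩ := hA.1
      have h : ∀ b ∈ A, b = c := fun b hb => hvert b c (hA.mem_smallVertices hAs hb) hcs
      exact Set.eq_singleton_iff_unique_mem.2 ⟨h a ha ▸ ha, h⟩
    obtain rfl := honly C₀ hC₀ hC₀s
    have hmins : ∀ A₀, G.IsFragment k A₀ →
        ∃ A ⊆ A₀, G.IsFragment k A ∧ ∀ B ⊆ A, G.IsFragment k B → B = A := fun A₀ hA₀ => by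
      refine (hG.1.exists_minimal_fragment_or_end hA₀).resolve_right ?_
      rintro ⟨ω, hω, -⟩
      exact absurd (huniq (Sum.inl c) (Or.inl ⟨c, hcs, rfl⟩) (Sum.inr ω) (Or.inr ⟨ω, hω, rfl⟩))
        Sum.inl_ne_inr
    have key : ∀ A, G.IsFragment k A → (∀ B ⊆ A, G.IsFragment k B → B = A) → c ∉ A →
        ∀ x ∈ A, x ∉ G.outerBoundary {c} → ∀ C, G.IsFragment k C → x ∈ G.outerBoundary C →
        (A ∪ G.outerBoundary A)ᶜ = {c} ∧ c ∈ G.outerBoundary C := by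
      intro A hA hmin hcA x hx hxc C hC hxC
      have h := hA.small_compl_of_minimal hG.1 hmin hC hx hxC
        (fun h => hcA ((honly A hA h).symm ▸ rfl : c ∈ A))
        (fun h => hxc (honly C hC h ▸ hxC))
        (fun h => hxc (by
          rw [← honly _ (hC.compl hG.1) h, hC.outerBoundary_compl hG.1]
          exact hxC))
      have h2 := honly _ (hA.compl hG.1) h.2
      exact ⟨h2, h.1 (h2.symm ▸ rfl)⟩
    obtain ⟨A₁, hA₁c, hA₁, hA₁min⟩ := hmins _ (hC₀.compl hG.1)
    obtain ⟨x, hx⟩ := hA₁.1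
    have hxc : x ∉ G.outerBoundary {c} := fun h => hA₁c hx (Or.inr h)
    have hxc' : x ≠ c := fun h => hA₁c hx (Or.inl h)
    obtain ⟨C, hC, hxC⟩ := hfrag x
    have hcC := (key A₁ hA₁ hA₁min (fun h => hA₁c h (Or.inl rfl)) x hx hxc C hC hxC).2
    -- A vertex of `A` that is not a neighbour of `c` would, by `key`, make `{c}` the far side of
    -- `A`, so that the neighbours of `c` are the outer boundary of `A`. Then `x` has no place left.
    have hsub : ∀ A, G.IsFragment k A → (∀ B ⊆ A, G.IsFragment k B → B = A) → c ∉ A → x ∉ A →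
        A ⊆ G.outerBoundary {c} := by
      intro A hA hmin hcA hxA y hy
      by_contra hyc
      obtain ⟨C', hC', hyC'⟩ := hfrag y
      have h := (key A hA hmin hcA y hy hyc C' hC' hyC').1
      have h2 := hA.outerBoundary_compl hG.1
      rw [h] at h2
      rw [h2] at hxc
      have hx' : x ∈ (A ∪ G.outerBoundary A)ᶜ := fun h => h.elim hxA hxc
      rw [h] at hx'
      exact hxc' hx'
    obtain ⟨A₂, hA₂C, hA₂, hA₂min⟩ := hmins _ hC
    obtain ⟨A₃, hA₃C, hA₃, hA₃min⟩ := hmins _ (hC.compl hG.1)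
    have hcA₂ : c ∉ A₂ := fun h => hcC.1 (hA₂C h)
    have hcA₃ : c ∉ A₃ := fun h => hA₃C h (Or.inr hcC)
    have hs₂ := hsub A₂ hA₂ hA₂min hcA₂ fun h => hxC.1 (hA₂C h)
    have hs₃ := hsub A₃ hA₃ hA₃min hcA₃ fun h => hA₃C h (Or.inr hxC)
    have hdisj : Disjoint A₂ A₃ := Set.disjoint_left.2 fun y h2 h3 => hA₃C h3 (Or.inl (hA₂C h2))
    -- Two disjoint fragments, each with more than `k / 2` vertices, cannot both fit among the `k`
    -- neighbours of `c`.
    have hcard := Set.ncard_le_ncard (Set.union_subset hs₂ hs₃) hC₀.finite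
    have hf₂ := hC₀.finite.subset hs₂
    have hf₃ := hC₀.finite.subset hs₃
    rw [hC₀.ncard, Set.ncard_union_eq hdisj hf₂ hf₃] at hcard
    have hlarge : ∀ A, G.IsFragment k A → c ∉ A → A.Finite → k < 2 * A.ncard := by
      intro A hA hcA hAf
      by_contra hle
      refine hcA ((honly A hA ?_).symm ▸ rfl : c ∈ A)
      rw [← hAf.cast_ncard_eq]
      exact_mod_cast not_lt.1 hle
    have := hlarge A₂ hA₂ hcA₂ hf₂
    have := hlarge A₃ hA₃ hcA₃ hf₃
    omega
  -- Without small fragments no fragment is minimal, so each of the two sides of a separator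
  -- contains an end.
  · have hns : ∀ A, G.IsFragment k A → ¬ 2 * A.encard ≤ k := fun A hA h => hsm ⟨A, hA, h⟩
    have hend : ∀ A₀, G.IsFragment k A₀ →
        ∃ ω : G.Ends, ω ∈ G.endsSmallVertexDegree k ∧ LivesIn ω A₀ := fun A₀ hA₀ => by
      refine (hG.1.exists_minimal_fragment_or_end hA₀).resolve_left ?_
      rintro ⟨A, -, hA, hmin⟩
      obtain ⟨x, hx⟩ := hA.1
      obtain ⟨C, hC, hxC⟩ := hfrag x
      exact hns _ (hA.compl hG.1) (hA.small_compl_of_minimal hG.1 hmin hC hx hxC (hns A hA)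
        (hns C hC) (hns _ (hC.compl hG.1))).2
    have hne : Nonempty V := by
      rw [← mk_ne_zero_iff]
      exact (bot_le.trans_lt hG.1.1).ne'
    obtain ⟨v⟩ := hne
    obtain ⟨C, hC, -⟩ := hfrag v
    obtain ⟨ω, hω, hωC⟩ := hend C hC
    obtain ⟨ω', hω', hωC'⟩ := hend _ (hC.compl hG.1)
    exact hωC.ne hωC' (Set.disjoint_left.2 fun y hy h => h (Or.inl hy)) (Sum.inr_injective
      (huniq (Sum.inr ω) (Or.inr ⟨ω, hω, rfl⟩) (Sum.inr ω') (Or.inr ⟨ω', hω', rfl⟩)))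

end SimpleGraph

theorem theorem4 {V : Type*} (G : SimpleGraph V) :
    (G.IsEdgeMinKConnected 1 →
      (ℵ₀ < #V →
        #V ≤ #(G.vertexEndUnion (G.smallVertices 1) (G.endsSmallEdgeDegree 1)) ∧
        (#G.Ends ≤ #V →
          #(G.vertexEndUnion (G.smallVertices 1) (G.endsSmallEdgeDegree 1)) = #V)) ∧
      (#V ≤ ℵ₀ →
        2 ≤ #(G.vertexEndUnion (G.smallVertices 1) (G.endsSmallEdgeDegree 1)))) ∧
    (∀ k : ℕ, 1 ≤ k → G.IsVertexMinKConnected k → (k = 1 → #V ≠ 2) →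
      2 ≤ #(G.vertexEndUnion (G.smallVertices (3 * k / 2 - 1)) (G.endsSmallVertexDegree k))) ∧
    (∀ k : ℕ, 1 ≤ k → G.IsEdgeMinKEdgeConnected k →
      2 ≤ #(G.vertexEndUnion (G.smallVertices k) (G.endsSmallEdgeDegree k))) ∧
    (∀ k : ℕ, 1 ≤ k → G.IsVertexMinKEdgeConnected k →
      2 ≤ #(G.vertexEndUnion (G.smallVertices k) (G.endsSmallVertexDegree k))) := by
  exact ⟨fun h => h.vertexEndUnion_one, fun _ hk h hV => h.two_le hk hV,
    fun _ hk h => h.two_le hk, fun _ hk h => h.two_le hk⟩
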